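/- **Theorem 1.3.** For a finite set $\Lambda\subset\mathbb{Z}^d$, let $\vec E(\Lambda)$ be the set of ordered pairs $(i,j)$ of nearest neighbours in $\Lambda$ (so each unoriented edge occurs with both orientations). Given $\beta>0$, a field $h=(h_j)_{j\in\Lambda}\in\mathbb{R}^\Lambda$, an antisymmetric family $\omega=(\omega_{i,j})_{(i,j)\in\vec E(\Lambda)}$, $\omega_{i,j}=-\omega_{j,i}$, and phases $\psi=(\psi_j)_{j\in\Lambda}$, let $$H_{\omega,\psi,\beta,h,\Lambda}(\theta)=\frac{\beta}{2}\sum_{(i,j)\in\vec E(\Lambda)}\cos(\theta(i)-\theta(j)+\omega_{i,j})+\sum_{j\in\Lambda}h_j\cos(\theta(j)+\psi_j),$$ and let $\langle\cdot\rangle_{\omega,\psi,\beta,h,\Lambda}$ be the expectation with respect to the probability measure on $\theta\in[0,2\pi)^\Lambda$ with density proportional to $e^{H_{\omega,\psi,\beta,h,\Lambda}(\theta)}\prod_{i\in\Lambda}d\theta(i)$ (free boundary conditions). Let $\mathbb{E}_{\beta,h}$ be the expectation over the disorder $(\omega,\psi)$ on the Nishimori line: the $\omega_{i,j}$ (one orientation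 being chosen for each unoriented edge) and the $\psi_j$ are all independent and take values in $[-\pi,\pi)$, each $\omega_{i,j}$ has density proportional to $e^{\beta\cos t}$, and $\psi_j$ has density proportional to $e^{h_j\cos t}$. Let $d\ge 3$. There exist constants $\beta^*,a>0$, depending only on $d$, such that for all $\beta\ge\beta^*$, all finite $\Lambda\subset\mathbb{Z}^d$, all fields $h\in\mathbb{R}^\Lambda$, and all $x,y\in\Lambda$ such that $\Lambda$ contains every point of $\mathbb{Z}^d$ in the open Euclidean ball $B\big(\tfrac{x+y}{2},\,2\|x-y\|_2\big)$, $$\mathbb{E}_{\beta,h}\Big[\big\langle\cos(\theta(x)-\theta(y))\big\rangle_{\omega,\psi,\beta,h,\Lambda}\Big]\;\ge\;1-\sqrt{\frac{a\log\beta}{\beta}}.$$ Moreover, when $h\equiv 0$ the interaction is invariant under global rotations: $H_{\omega,\psi,\beta,0,\Lambda}(\theta+\alpha)=H_{\omega,\psi,\beta,0,\Lambda}(\theta)$ for all $\Lambda,\omega,\psi,\beta,\theta$ and all $\alpha\in\mathbb{R}$, where $(\theta+\alpha)(j)=\theta(j)+\alpha$. -/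

import Mathlib

namespace NishimoriXY

noncomputable section

/-- Vertices of the lattice `ℤ^d`. -/
abbrev Site (d : ℕ) : Type := Fin d → ℤ

/-- The lattice point `z` seen as a point of Euclidean space `ℝ^d`. -/
def Site.toEuclidean {d : ℕ} (z : Site d) : EuclideanSpace ℝ (Fin d) :=
  WithLp.toLp 2 (fun k => (z k : ℝ))

/-- Nearest neighbours of `ℤ^d`: the points at `ℓ¹`-distance one. -/
def NearestNeighbor {d : ℕ} (i j : Site d) : Prop := ∑ k, |i k - j k| = 1

open Classical in
/-- The set of oriented edges of `Λ`: every unoriented edge occurs with both orientations. -/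
def orientedEdges {d : ℕ} (Λ : Finset (Site d)) : Finset (Λ × Λ) :=
  Finset.univ.filter (fun e => NearestNeighbor (e.1 : Site d) (e.2 : Site d))

open Classical in
/-- One orientation for each unoriented edge of `Λ`, namely the one pointing in a positive
coordinate direction (`≤` is the coordinatewise order of `ℤ^d`). -/
def positiveEdges {d : ℕ} (Λ : Finset (Site d)) : Finset (Λ × Λ) :=
  (orientedEdges Λ).filter (fun e => (e.1 : Site d) ≤ (e.2 : Site d))

open Classical in
/-- The `1`-form `ω` on `Λ` with prescribed values `η` on the positively oriented edges:
`ω i j = - ω j i`. (It is set to `0` on pairs that are not edges.) -/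
def oneForm {d : ℕ} (Λ : Finset (Site d)) (η : positiveEdges Λ → ℝ) (i j : Λ) : ℝ :=
  if hij : (i, j) ∈ positiveEdges Λ then η ⟨(i, j), hij⟩
  else if hji : (j, i) ∈ positiveEdges Λ then - η ⟨(j, i), hji⟩
  else 0

/-- The normalization `∫_{-π}^{π} e^{u cos t} dt`. -/
def phaseNormalization (u : ℝ) : ℝ :=
  ∫ t in Set.Ico (-Real.pi) Real.pi, Real.exp (u * Real.cos t)

/-- The probability law on `[-π, π)` whose density is proportional to `e^{u cos t}`. -/
def phaseLaw (u : ℝ) : MeasureTheory.Measure ℝ :=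
  (MeasureTheory.volume.restrict (Set.Ico (-Real.pi) Real.pi)).withDensity
    (fun t => ENNReal.ofReal ((phaseNormalization u)⁻¹ * Real.exp (u * Real.cos t)))

instance phaseLaw_isProbabilityMeasure (u : ℝ) :
    MeasureTheory.IsProbabilityMeasure (phaseLaw u) := by
  have hpi := Real.pi_pos
  have hint : MeasureTheory.IntegrableOn (fun t => Real.exp (u * Real.cos t))
      (Set.Ico (-Real.pi) Real.pi) MeasureTheory.volume :=
    ((Continuous.continuousOn (by fun_prop)).integrableOn_compact
      (K := Set.Icc (-Real.pi) Real.pi) isCompact_Icc).mono_set Set.Ico_subset_Icc_self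
  have hpos : 0 < phaseNormalization u := by
    unfold phaseNormalization
    rw [MeasureTheory.setIntegral_pos_iff_support_of_nonneg_ae
      (Filter.Eventually.of_forall fun t => (Real.exp_pos _).le) hint]
    have : Function.support (fun t => Real.exp (u * Real.cos t)) = Set.univ := by
      ext t; simp [Real.exp_ne_zero]
    rw [this, Set.univ_inter, Real.volume_Ico]
    exact ENNReal.ofReal_pos.2 (by linarith)
  constructor
  rw [phaseLaw, MeasureTheory.withDensity_apply _ MeasurableSet.univ,
    MeasureTheory.Measure.restrict_univ,
    ← MeasureTheory.ofReal_integral_eq_lintegral_ofReal (hint.const_mul _)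
      (Filter.Eventually.of_forall fun t => by positivity),
    MeasureTheory.integral_const_mul]
  change ENNReal.ofReal ((phaseNormalization u)⁻¹ * phaseNormalization u) = 1
  rw [inv_mul_cancel₀ hpos.ne', ENNReal.ofReal_one]

/-- The exponent of the Gibbs weight with bond disorder `ω` and field phases `ψ`:
`(β/2) ∑ cos (θ i - θ j + ω i j) + ∑ h j cos (θ j + ψ j)`, the first sum over all oriented edges. -/
def interaction {d : ℕ} (Λ : Finset (Site d)) (β : ℝ) (h : Λ → ℝ)
    (ω : Λ → Λ → ℝ) (ψ : Λ → ℝ) (θ : Λ → ℝ) : ℝ :=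
  β / 2 * ∑ e ∈ orientedEdges Λ, Real.cos (θ e.1 - θ e.2 + ω e.1 e.2)
    + ∑ j, h j * Real.cos (θ j + ψ j)

/-- The spin configurations, given by angles in `[0, 2π)`. -/
def spins {d : ℕ} (Λ : Finset (Site d)) : Set (Λ → ℝ) :=
  Set.univ.pi (fun _ => Set.Ico 0 (2 * Real.pi))

/-- The quenched partition function (free boundary conditions). -/
def partitionFunction {d : ℕ} (Λ : Finset (Site d)) (β : ℝ) (h : Λ → ℝ)
    (ω : Λ → Λ → ℝ) (ψ : Λ → ℝ) : ℝ :=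
  ∫ θ in spins Λ, Real.exp (interaction Λ β h ω ψ θ)

/-- The quenched Gibbs expectation of an observable `f` (free boundary conditions). -/
def gibbs {d : ℕ} (Λ : Finset (Site d)) (β : ℝ) (h : Λ → ℝ)
    (ω : Λ → Λ → ℝ) (ψ : Λ → ℝ) (f : (Λ → ℝ) → ℝ) : ℝ :=
  (partitionFunction Λ β h ω ψ)⁻¹ *
    ∫ θ in spins Λ, f θ * Real.exp (interaction Λ β h ω ψ θ)

/-- The disorder law on the Nishimori line: all phases are independent, the bond phases have
density proportional to `e^{β cos}` and the field phase at `j` to `e^{h j cos}`. -/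
def disorderLaw {d : ℕ} (Λ : Finset (Site d)) (β : ℝ) (h : Λ → ℝ) :
    MeasureTheory.Measure ((positiveEdges Λ → ℝ) × (Λ → ℝ)) :=
  (MeasureTheory.Measure.pi (fun _ : positiveEdges Λ => phaseLaw β)).prod
    (MeasureTheory.Measure.pi (fun j : Λ => phaseLaw (h j)))

/-- The averaged quenched expectation of `f` on the Nishimori line. -/
def averagedGibbs {d : ℕ} (Λ : Finset (Site d)) (β : ℝ) (h : Λ → ℝ)
    (f : (Λ → ℝ) → ℝ) : ℝ :=
  ∫ p, gibbs Λ β h (oneForm Λ p.1) p.2 f ∂(disorderLaw Λ β h)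

end

end NishimoriXY

/-! ### Reduction modulo a period, and densities of product measures. -/

section

open MeasureTheory Set

/-! The density of the disorder is proportional to its Gibbs weight at the zero configuration, and a
gauge shift by `θ` turns this weight into the Gibbs weight of `θ` (`disorderWeight_gaugeShift`).
Averaging over gauges, the mean of `⟨cos (θ x - θ y)⟩` equals the mean of the squared modulus of
`⟨exp (i (θ x - θ y))⟩`. In Bayesian terms the Gibbs state is a posterior, and any function `T = t₁
+ i t₂` of the disorder that rotates like `exp (i (θ x - θ y))` is a competing estimator. Completing
a square gives the lower bound `2 E t₁ - E |T|²` (`gauge_lower_bound`).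

The estimator averages, over random paths from `x` to `y`, the product of the bond phases along the
path, divided by `c ^ length` with `c = phaseFourier β 1`. Then `E T = 1`, and `E |T|²` is at most
the mean of `c⁻¹ ^ (2 · number of common edges)` over two independent paths
(`second_moment_le_averagedGibbs`). Only bonds enter, so the bound is uniform in `h`.

What is needed is a random path whose intersections with an independent copy have bounded
exponential moments. One coordinate is a clock, and two transverse coordinates follow independent
multiscale staircases: the scale `j` displacement in a block of length `8 ^ j` is uniform on about
`4 ^ j / 2` values. Given the past, a near-collision after a lag of order `8 ^ j` has probability of
order `16 ^ (-j)`. This is summable over lags because there are two transverse directions, which is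
where `d ≥ 3` enters. A renewal inequality then gives `E |T|² ≤ 1 + O(c⁻¹ ^ 12 - 1)`
(`sum_prod_hit_le`).

Reflecting a path in the midplane makes it end at `y`. This treats points on a common axis line;
general pairs are joined by `d` axis segments through the inequality `1 - cos (u + v) ≤ 2 (1 - cos
u) + 2 (1 - cos v)`. An entropy bound gives `1 - c ≤ 4 log β / β`, so the argument yields an error
of order `log β / β`, which is smaller than the square root that is claimed. -/

theorem measurable_toIcoMod {T : ℝ} (hT : 0 < T) (a : ℝ) : Measurable (toIcoMod hT a) := by
  have : toIcoMod hT a = fun b => a + Int.fract ((b - a) / T) * T :=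
    funext fun b => toIcoMod_eq_add_fract_mul hT a b
  rw [this]
  fun_prop

/-- Preimages under `toIcoMod` are periodic, and a periodic set has the same measure in any two
fundamental domains of `zmultiples T`. The change between `Ico` and `Ioc` is a null set. -/
theorem measurePreserving_toIcoMod {T : ℝ} (hT : 0 < T) (a b : ℝ) :
    MeasurePreserving (toIcoMod hT a) (volume.restrict (Ico b (b + T)))
      (volume.restrict (Ico a (a + T))) := by
  refine ⟨measurable_toIcoMod hT a, ?_⟩
  ext A hA
  have hm := measurable_toIcoMod hT a hA
  have hper := (isAddFundamentalDomain_Ioc hT b).measure_set_eq (μ := volume)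
    (isAddFundamentalDomain_Ioc hT a) hm (by
      rintro ⟨g, n, rfl⟩
      ext x
      simp only [mem_preimage]
      have : (toIcoMod hT a) ((⟨(fun x => x • T) n, n, rfl⟩ : AddSubgroup.zmultiples T) +ᵥ x)
          = toIcoMod hT a x := by
        change toIcoMod hT a (n • T + x) = _
        rw [add_comm, toIcoMod_add_zsmul]
      rw [this])
  rw [Measure.map_apply (measurable_toIcoMod hT a) hA, Measure.restrict_apply hm,
    Measure.restrict_apply hA,
    measure_congr ((ae_eq_refl (toIcoMod hT a ⁻¹' A)).inter
      (Ico_ae_eq_Ioc (μ := volume) (a := b) (b := b + T))), hper,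
    measure_congr ((ae_eq_refl (toIcoMod hT a ⁻¹' A)).inter
      (Ico_ae_eq_Ioc (μ := volume) (a := a) (b := a + T)).symm)]
  congr 1
  ext x
  simp only [mem_inter_iff, mem_preimage, and_congr_left_iff]
  intro hx
  rw [(toIcoMod_eq_self hT).2 hx]

theorem measurePreserving_toIcoMod_add {T : ℝ} (hT : 0 < T) (a v : ℝ) :
    MeasurePreserving (fun t => toIcoMod hT a (t + v)) (volume.restrict (Ico a (a + T)))
      (volume.restrict (Ico a (a + T))) := by
  have h := (measurePreserving_add_right (volume : Measure ℝ) v).restrict_preimage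
    (s := Ico (a + v) (a + v + T)) measurableSet_Ico
  have h2 : (fun x => x + v) ⁻¹' Ico (a + v) (a + v + T) = Ico a (a + T) := by
    ext x
    simp only [mem_preimage, mem_Ico]
    constructor <;> rintro ⟨h1, h2⟩ <;> constructor <;> linarith
  rw [h2] at h
  exact (measurePreserving_toIcoMod hT a (a + v)).comp h

theorem pi_withDensity_ofReal {ι : Type*} [Fintype ι] (ν : ι → Measure ℝ)
    [∀ i, IsFiniteMeasure (ν i)] (f : ι → ℝ → ℝ) (hf : ∀ i t, 0 ≤ f i t)
    (hfi : ∀ i, Integrable (f i) (ν i)) :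
    Measure.pi (fun i => (ν i).withDensity (fun t => ENNReal.ofReal (f i t))) =
      (Measure.pi ν).withDensity (fun x => ENNReal.ofReal (∏ i, f i (x i))) := by
  have hfin : ∀ i, IsFiniteMeasure ((ν i).withDensity (fun t => ENNReal.ofReal (f i t))) :=
    fun i => isFiniteMeasure_withDensity_ofReal (hfi i).2
  refine Measure.pi_eq fun s hs => ?_
  rw [withDensity_apply _ (MeasurableSet.univ_pi hs), Measure.restrict_pi_pi,
    ← ofReal_integral_eq_lintegral_ofReal]
  · rw [integral_fintype_prod_eq_prod (fun i => f i), ENNReal.ofReal_prod_of_nonneg]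
    · refine Finset.prod_congr rfl fun i _ => ?_
      rw [withDensity_apply _ (hs i),
        ofReal_integral_eq_lintegral_ofReal ((hfi i).restrict) (ae_of_all _ (hf i))]
    · exact fun i _ => integral_nonneg (hf i)
  · exact Integrable.fintype_prod (f := fun i => f i) fun i => (hfi i).restrict
  · exact ae_of_all _ fun x => Finset.prod_nonneg fun i _ => hf i _

/-! ### The gauge inequality in abstract form. -/

section Gauge

variable {X Θ : Type*} [MeasurableSpace X] [MeasurableSpace Θ]

/-- Abstract gauge argument on the Nishimori line.  A family `g` of measure preserving maps acts
on the disorder space `X`; `w (g θ ξ)` is the Gibbs weight of the configuration `θ` in the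
disorder `ξ`, and `w` is also the density of the disorder.  Any `(t₁, t₂)` rotating like
`(c, s)` under `g` yields a lower bound for the averaged quenched correlation. -/
theorem gauge_lower_bound (μ : Measure X) (ν : Measure Θ) [IsFiniteMeasure μ] [IsFiniteMeasure ν]
    (hν : ν ≠ 0)
    (g : Θ → X → X) (hg : Measurable (Function.uncurry g))
    (hgμ : ∀ φ, MeasurePreserving (g φ) μ μ)
    (σ : Θ → Θ → Θ) (hσ : ∀ φ, MeasurePreserving (σ φ) ν ν)
    (w : X → ℝ) (hw : Measurable w) (m M : ℝ) (hm : 0 < m) (hmw : ∀ ξ, m ≤ w ξ)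
    (hwM : ∀ ξ, w ξ ≤ M)
    (hwg : ∀ φ θ ξ, w (g θ (g φ ξ)) = w (g (σ φ θ) ξ))
    (c s : Θ → ℝ) (hc : Measurable c) (hs : Measurable s) (hcs : ∀ θ, c θ ^ 2 + s θ ^ 2 = 1)
    (hcσ : ∀ φ θ, c (σ φ θ) = c θ * c φ - s θ * s φ)
    (hsσ : ∀ φ θ, s (σ φ θ) = s θ * c φ + c θ * s φ)
    (t₁ t₂ : X → ℝ) (ht₁ : Measurable t₁) (ht₂ : Measurable t₂) (K : ℝ)
    (hK₁ : ∀ ξ, |t₁ ξ| ≤ K) (hK₂ : ∀ ξ, |t₂ ξ| ≤ K)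
    (ht₁g : ∀ θ ξ, t₁ (g θ ξ) = c θ * t₁ ξ - s θ * t₂ ξ)
    (ht₂g : ∀ θ ξ, t₂ (g θ ξ) = s θ * t₁ ξ + c θ * t₂ ξ) :
    2 * ∫ ξ, t₁ ξ * w ξ ∂μ - ∫ ξ, (t₁ ξ ^ 2 + t₂ ξ ^ 2) * w ξ ∂μ ≤
      ∫ ξ, w ξ * ((∫ θ, w (g θ ξ) ∂ν)⁻¹ * ∫ θ, c θ * w (g θ ξ) ∂ν) ∂μ := by
  have hgx : ∀ ξ, Measurable (fun θ => g θ ξ) := fun ξ => hg.comp measurable_prodMk_right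
  have hW : Measurable (fun p : X × Θ => w (g p.2 p.1)) := hw.comp (hg.comp measurable_swap)
  have hWa : ∀ ξ, |w ξ| ≤ M := fun ξ => by
    rw [abs_of_pos (hm.trans_le (hmw ξ))]; exact hwM ξ
  have hM : 0 ≤ M ∨ IsEmpty X := by
    rcases isEmpty_or_nonempty X with h | ⟨⟨ξ⟩⟩
    · exact Or.inr h
    · exact Or.inl (hm.le.trans ((hmw ξ).trans (hwM ξ)))
  rcases hM with hM | hX
  swap
  · simp [Measure.eq_zero_of_isEmpty μ]
  have hc1 : ∀ θ, |c θ| ≤ 1 := fun θ => abs_le_one_iff_mul_self_le_one.2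
    (by nlinarith [hcs θ, sq_nonneg (s θ)])
  have hs1 : ∀ θ, |s θ| ≤ 1 := fun θ => abs_le_one_iff_mul_self_le_one.2
    (by nlinarith [hcs θ, sq_nonneg (c θ)])
  set Z : X → ℝ := fun ξ => ∫ θ, w (g θ ξ) ∂ν with hZdef
  set a : X → ℝ := fun ξ => ∫ θ, c θ * w (g θ ξ) ∂ν with hadef
  set b : X → ℝ := fun ξ => ∫ θ, s θ * w (g θ ξ) ∂ν with hbdef
  have hZm : Measurable Z := hW.stronglyMeasurable.integral_prod_right'.measurable
  have ham : Measurable a :=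
    ((hc.comp measurable_snd).mul hW).stronglyMeasurable.integral_prod_right'.measurable
  have hbm : Measurable b :=
    ((hs.comp measurable_snd).mul hW).stronglyMeasurable.integral_prod_right'.measurable
  have hV : 0 < ν.real univ := by
    rw [measureReal_def]
    exact ENNReal.toReal_pos (by simpa using hν) (measure_ne_top _ _)
  set V := ν.real univ
  have hWi : ∀ ξ, Integrable (fun θ => w (g θ ξ)) ν := fun ξ =>
    Integrable.of_bound (hw.comp (hgx ξ)).aestronglyMeasurable M (ae_of_all _ fun θ => hWa _)
  have hmul : ∀ u v : ℝ, |u| ≤ 1 → |v| ≤ M → |u * v| ≤ M := fun u v hu hv => by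
    rw [abs_mul]; nlinarith [abs_nonneg u, abs_nonneg v]
  have hai : ∀ ξ, Integrable (fun θ => c θ * w (g θ ξ)) ν := fun ξ =>
    Integrable.of_bound (hc.mul (hw.comp (hgx ξ))).aestronglyMeasurable M
      (ae_of_all _ fun θ => hmul _ _ (hc1 θ) (hWa _))
  have hbi : ∀ ξ, Integrable (fun θ => s θ * w (g θ ξ)) ν := fun ξ =>
    Integrable.of_bound (hs.mul (hw.comp (hgx ξ))).aestronglyMeasurable M
      (ae_of_all _ fun θ => hmul _ _ (hs1 θ) (hWa _))
  have hZlow : ∀ ξ, m * V ≤ Z ξ := fun ξ => by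
    have := integral_mono (μ := ν) (integrable_const m) (hWi ξ) (fun θ => hmw (g θ ξ))
    simpa [V, mul_comm] using this
  have hZpos : ∀ ξ, 0 < Z ξ := fun ξ => (mul_pos hm hV).trans_le (hZlow ξ)
  have hZup : ∀ ξ, |Z ξ| ≤ M * V := fun ξ => by
    have := norm_integral_le_of_norm_le_const (μ := ν) (f := fun θ => w (g θ ξ))
      (ae_of_all _ fun θ => hWa (g θ ξ))
    simpa [V, mul_comm] using this
  have haup : ∀ ξ, |a ξ| ≤ M * V := fun ξ => by
    have := norm_integral_le_of_norm_le_const (μ := ν) (f := fun θ => c θ * w (g θ ξ))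
      (ae_of_all _ fun θ => hmul _ _ (hc1 θ) (hWa (g θ ξ)))
    exact this
  have hbup : ∀ ξ, |b ξ| ≤ M * V := fun ξ => by
    have := norm_integral_le_of_norm_le_const (μ := ν) (f := fun θ => s θ * w (g θ ξ))
      (ae_of_all _ fun θ => hmul _ _ (hs1 θ) (hWa (g θ ξ)))
    exact this
  have hcv : ∀ φ (F : Θ → ℝ), Measurable F → ∫ θ, F (σ φ θ) ∂ν = ∫ θ, F θ ∂ν := fun φ F hF => by
    conv_rhs => rw [← (hσ φ).map_eq]
    exact (integral_map (hσ φ).measurable.aemeasurable hF.aestronglyMeasurable).symm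
  have hcx : ∀ φ (F : X → ℝ), Measurable F → ∫ ξ, F (g φ ξ) ∂μ = ∫ ξ, F ξ ∂μ := fun φ F hF => by
    conv_rhs => rw [← (hgμ φ).map_eq]
    exact (integral_map (hgμ φ).measurable.aemeasurable hF.aestronglyMeasurable).symm
  have hZg : ∀ φ ξ, Z (g φ ξ) = Z ξ := fun φ ξ => by
    simp only [hZdef, hwg]
    exact hcv φ (fun θ => w (g θ ξ)) (hw.comp (hgx ξ))
  -- The unnormalised Gibbs mean `a + i b` picks up the inverse phase of `φ`, opposite to `t₁ + i
  -- t₂`.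
  have hag : ∀ φ ξ, a (g φ ξ) = c φ * a ξ + s φ * b ξ := fun φ ξ => by
    have h1 : ∀ θ, c θ * w (g θ (g φ ξ)) =
        (fun θ => c φ * (c θ * w (g θ ξ)) + s φ * (s θ * w (g θ ξ))) (σ φ θ) := fun θ => by
      simp only [hwg, hcσ, hsσ]
      linear_combination -(c θ * w (g (σ φ θ) ξ)) * hcs φ
    simp only [hadef, hbdef, h1]
    rw [hcv φ (fun θ => c φ * (c θ * w (g θ ξ)) + s φ * (s θ * w (g θ ξ)))
      (((hc.mul (hw.comp (hgx ξ))).const_mul _).add ((hs.mul (hw.comp (hgx ξ))).const_mul _)),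
      integral_add ((hai ξ).const_mul _) ((hbi ξ).const_mul _), integral_const_mul,
      integral_const_mul]
  have hswap : ∀ F : X → Θ → ℝ, Measurable (Function.uncurry F) → ∀ C : ℝ, (∀ ξ θ, |F ξ θ| ≤ C) →
      ∫ θ, ∫ ξ, F ξ θ ∂μ ∂ν = ∫ ξ, ∫ θ, F ξ θ ∂ν ∂μ := fun F hF C hC =>
    (integral_integral_swap (Integrable.of_bound hF.aestronglyMeasurable C
      (ae_of_all _ fun p => hC p.1 p.2))).symm
  have hK0 : ∀ ξ : X, 0 ≤ K := fun ξ => (abs_nonneg _).trans (hK₁ ξ)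
  -- Nishimori identity: after a shift by `φ` the disorder density `w (g φ ξ)` is the Gibbs weight
  -- of `φ`, so integrating over `φ` creates a second, independent replica.
  have hJ : V * ∫ ξ, w ξ * ((Z ξ)⁻¹ * a ξ) ∂μ = ∫ ξ, (Z ξ)⁻¹ * (a ξ ^ 2 + b ξ ^ 2) ∂μ := by
    have h1 : ∀ φ, ∫ ξ, w (g φ ξ) * ((Z ξ)⁻¹ * (c φ * a ξ + s φ * b ξ)) ∂μ =
        ∫ ξ, w ξ * ((Z ξ)⁻¹ * a ξ) ∂μ := fun φ => by
      rw [← hcx φ (fun ξ => w ξ * ((Z ξ)⁻¹ * a ξ)) (hw.mul (hZm.inv.mul ham))]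
      simp only [hZg, hag]
    have h2 := hswap (fun ξ φ => w (g φ ξ) * ((Z ξ)⁻¹ * (c φ * a ξ + s φ * b ξ)))
      (hW.mul ((hZm.comp measurable_fst).inv.mul (((hc.comp measurable_snd).mul
        (ham.comp measurable_fst)).add ((hs.comp measurable_snd).mul (hbm.comp measurable_fst)))))
      (M * ((m * V)⁻¹ * (M * V + M * V))) (fun ξ φ => by
        rw [abs_mul, abs_mul]
        have h3 : |c φ * a ξ + s φ * b ξ| ≤ M * V + M * V := by
          refine (abs_add_le _ _).trans ?_
          rw [abs_mul, abs_mul]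
          exact add_le_add ((mul_le_of_le_one_left (abs_nonneg _) (hc1 φ)).trans (haup ξ))
            ((mul_le_of_le_one_left (abs_nonneg _) (hs1 φ)).trans (hbup ξ))
        have h4 : |(Z ξ)⁻¹| ≤ (m * V)⁻¹ := by
          rw [abs_inv, abs_of_pos (hZpos ξ)]
          exact inv_anti₀ (mul_pos hm hV) (hZlow ξ)
        have := mul_pos hm hV
        gcongr
        exact hWa _)
    simp only [h1, integral_const, smul_eq_mul] at h2
    rw [h2]
    refine integral_congr_ae (ae_of_all _ fun ξ => ?_)
    have h5 : ∀ φ, w (g φ ξ) * ((Z ξ)⁻¹ * (c φ * a ξ + s φ * b ξ)) =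
        (Z ξ)⁻¹ * a ξ * (c φ * w (g φ ξ)) + (Z ξ)⁻¹ * b ξ * (s φ * w (g φ ξ)) := fun φ => by ring
    simp only [h5]
    rw [integral_add ((hai ξ).const_mul _) ((hbi ξ).const_mul _), integral_const_mul,
      integral_const_mul]
    change (Z ξ)⁻¹ * a ξ * a ξ + (Z ξ)⁻¹ * b ξ * b ξ = _
    ring
  have hP : V * ∫ ξ, t₁ ξ * w ξ ∂μ = ∫ ξ, (t₁ ξ * a ξ - t₂ ξ * b ξ) ∂μ := by
    have h1 : ∀ θ, ∫ ξ, (c θ * t₁ ξ - s θ * t₂ ξ) * w (g θ ξ) ∂μ = ∫ ξ, t₁ ξ * w ξ ∂μ := fun θ => by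
      rw [← hcx θ (fun ξ => t₁ ξ * w ξ) (ht₁.mul hw)]
      simp only [ht₁g]
    have h2 := hswap (fun ξ θ => (c θ * t₁ ξ - s θ * t₂ ξ) * w (g θ ξ))
      ((((hc.comp measurable_snd).mul (ht₁.comp measurable_fst)).sub
        ((hs.comp measurable_snd).mul (ht₂.comp measurable_fst))).mul hW)
      ((K + K) * M) (fun ξ θ => by
        rw [abs_mul]
        have h3 : |c θ * t₁ ξ - s θ * t₂ ξ| ≤ K + K := by
          refine (abs_sub _ _).trans ?_
          rw [abs_mul, abs_mul]
          exact add_le_add ((mul_le_of_le_one_left (abs_nonneg _) (hc1 θ)).trans (hK₁ ξ))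
            ((mul_le_of_le_one_left (abs_nonneg _) (hs1 θ)).trans (hK₂ ξ))
        have := hK0 ξ
        gcongr
        exact hWa _)
    simp only [h1, integral_const, smul_eq_mul] at h2
    rw [h2]
    refine integral_congr_ae (ae_of_all _ fun ξ => ?_)
    have h5 : ∀ θ, (c θ * t₁ ξ - s θ * t₂ ξ) * w (g θ ξ) =
        t₁ ξ * (c θ * w (g θ ξ)) - t₂ ξ * (s θ * w (g θ ξ)) := fun φ => by ring
    simp only [h5]
    rw [integral_sub ((hai ξ).const_mul _) ((hbi ξ).const_mul _), integral_const_mul,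
      integral_const_mul]
  have hQ : V * ∫ ξ, (t₁ ξ ^ 2 + t₂ ξ ^ 2) * w ξ ∂μ = ∫ ξ, (t₁ ξ ^ 2 + t₂ ξ ^ 2) * Z ξ ∂μ := by
    have h1 : ∀ θ, ∫ ξ, (t₁ ξ ^ 2 + t₂ ξ ^ 2) * w (g θ ξ) ∂μ =
        ∫ ξ, (t₁ ξ ^ 2 + t₂ ξ ^ 2) * w ξ ∂μ := fun θ => by
      rw [← hcx θ (fun ξ => (t₁ ξ ^ 2 + t₂ ξ ^ 2) * w ξ) (((ht₁.pow_const 2).add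
        (ht₂.pow_const 2)).mul hw)]
      refine integral_congr_ae (ae_of_all _ fun ξ => ?_)
      simp only [ht₁g, ht₂g]
      linear_combination -((t₁ ξ ^ 2 + t₂ ξ ^ 2) * w (g θ ξ)) * hcs θ
    have h2 := hswap (fun ξ θ => (t₁ ξ ^ 2 + t₂ ξ ^ 2) * w (g θ ξ))
      (show Measurable (fun p : X × Θ => (t₁ p.1 ^ 2 + t₂ p.1 ^ 2) * w (g p.2 p.1)) from
        Measurable.mul (by fun_prop) hW)
      ((K ^ 2 + K ^ 2) * M) (fun ξ θ => by
        rw [abs_mul, abs_of_nonneg (by positivity), ← sq_abs (t₁ ξ), ← sq_abs (t₂ ξ)]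
        have := hK₁ ξ
        have := hK₂ ξ
        gcongr
        exact hWa _)
    simp only [h1, integral_const, smul_eq_mul] at h2
    rw [h2]
    exact integral_congr_ae (ae_of_all _ fun ξ => integral_const_mul _ _)
  have hab : ∀ ξ, |t₁ ξ * a ξ - t₂ ξ * b ξ| ≤ K * (M * V) + K * (M * V) := fun ξ => by
    refine (abs_sub _ _).trans ?_
    rw [abs_mul, abs_mul]
    have := hK₁ ξ
    have := hK₂ ξ
    have := haup ξ
    have := hbup ξ
    have := hK0 ξ
    gcongr
  have htt : ∀ ξ, |(t₁ ξ ^ 2 + t₂ ξ ^ 2) * Z ξ| ≤ (K ^ 2 + K ^ 2) * (M * V) := fun ξ => by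
    rw [abs_mul, abs_of_nonneg (by positivity), ← sq_abs (t₁ ξ), ← sq_abs (t₂ ξ)]
    have := hK₁ ξ
    have := hK₂ ξ
    gcongr
    exact hZup _
  have hi1 : Integrable (fun ξ => 2 * (t₁ ξ * a ξ - t₂ ξ * b ξ)) μ :=
    (Integrable.of_bound ((ht₁.mul ham).sub (ht₂.mul hbm)).aestronglyMeasurable _
      (ae_of_all _ hab)).const_mul 2
  have hi2 : Integrable (fun ξ => (t₁ ξ ^ 2 + t₂ ξ ^ 2) * Z ξ) μ :=
    Integrable.of_bound (by fun_prop) _ (ae_of_all _ htt)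
  have hmain : ∫ ξ, (2 * (t₁ ξ * a ξ - t₂ ξ * b ξ) - (t₁ ξ ^ 2 + t₂ ξ ^ 2) * Z ξ) ∂μ ≤
      ∫ ξ, (Z ξ)⁻¹ * (a ξ ^ 2 + b ξ ^ 2) ∂μ := by
    refine integral_mono (hi1.sub hi2)
      (Integrable.of_bound (hZm.inv.mul ((ham.pow_const 2).add
        (hbm.pow_const 2))).aestronglyMeasurable ((m * V)⁻¹ * ((M * V) ^ 2 + (M * V) ^ 2))
        (ae_of_all _ fun ξ => ?_)) fun ξ => ?_
    · rw [Real.norm_eq_abs, abs_mul, abs_inv, abs_of_pos (hZpos ξ),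
        abs_of_nonneg (by positivity : 0 ≤ a ξ ^ 2 + b ξ ^ 2), ← sq_abs (a ξ), ← sq_abs (b ξ)]
      have := haup ξ
      have := hbup ξ
      have h4 := inv_anti₀ (mul_pos hm hV) (hZlow ξ)
      have := mul_pos hm hV
      gcongr
    · have hz := hZpos ξ
      -- Completing the square compares `(a, b) / Z` with `(t₁, -t₂)`; the sign of `t₂` reflects the
      -- opposite rotations.
      have h6 : (Z ξ)⁻¹ * (a ξ ^ 2 + b ξ ^ 2) -
          (2 * (t₁ ξ * a ξ - t₂ ξ * b ξ) - (t₁ ξ ^ 2 + t₂ ξ ^ 2) * Z ξ) =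
          (Z ξ)⁻¹ * ((a ξ - t₁ ξ * Z ξ) ^ 2 + (b ξ + t₂ ξ * Z ξ) ^ 2) := by
        field_simp
        ring
      have h7 : 0 ≤ (Z ξ)⁻¹ * ((a ξ - t₁ ξ * Z ξ) ^ 2 + (b ξ + t₂ ξ * Z ξ) ^ 2) := by positivity
      simp only
      linarith
  rw [integral_sub hi1 hi2, integral_const_mul, ← hP, ← hQ, ← hJ] at hmain
  refine le_of_mul_le_mul_left ?_ hV
  linarith

end Gauge

end

/-! ### The gauge symmetry of the disordered XY model. -/

section

open MeasureTheory Set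

theorem exists_toIcoMod_eq_add {T : ℝ} (hT : 0 < T) (a x : ℝ) :
    ∃ k : ℤ, toIcoMod hT a x = x + k * T :=
  ⟨-toIcoDiv hT a x, by simp [toIcoMod, sub_eq_add_neg]⟩

/-- Integer coefficients keep multiples of `2π` multiples of `2π`, so path phases do not see the
reduction made by the gauge shift. -/
theorem cos_sin_sum_eq_of_congr {ι : Type*} [Fintype ι] (n : ι → ℤ) (x y : ι → ℝ)
    (h : ∀ i, ∃ k : ℤ, x i = y i + k * (2 * Real.pi)) :
    Real.cos (∑ i, n i * x i) = Real.cos (∑ i, n i * y i) ∧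
      Real.sin (∑ i, n i * x i) = Real.sin (∑ i, n i * y i) := by
  choose k hk using h
  have : ∑ i, n i * x i = ∑ i, n i * y i + ((∑ i, n i * k i : ℤ) : ℝ) * (2 * Real.pi) := by
    simp only [hk, mul_add, Finset.sum_add_distrib]
    push_cast
    rw [Finset.sum_mul]
    simp only [mul_assoc]
  rw [this, Real.cos_add_int_mul_two_pi, Real.sin_add_int_mul_two_pi]
  exact ⟨rfl, rfl⟩

theorem cos_toIcoMod {T : ℝ} (hT : 0 < T) (h2 : T = 2 * Real.pi) (a x : ℝ) :
    Real.cos (toIcoMod hT a x) = Real.cos x := by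
  obtain ⟨k, hk⟩ := exists_toIcoMod_eq_add hT a x
  rw [hk, h2, Real.cos_add_int_mul_two_pi]

namespace NishimoriXY

variable {d : ℕ} {Λ : Finset (Site d)}

theorem not_swap_mem_positiveEdges {i j : Λ} (h : (i, j) ∈ positiveEdges Λ) :
    (j, i) ∉ positiveEdges Λ := by
  intro h'
  simp only [positiveEdges, orientedEdges, Finset.mem_filter, Finset.mem_univ, true_and] at h h'
  have := le_antisymm h.2 h'.2
  have h1 := h.1
  simp [NearestNeighbor, this] at h1

theorem NearestNeighbor.le_or_le {i j : Site d} (h : NearestNeighbor i j) : i ≤ j ∨ j ≤ i := by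
  by_contra hcon
  push Not at hcon
  obtain ⟨h1, h2⟩ := hcon
  rw [Pi.le_def, not_forall] at h1 h2
  obtain ⟨k, hk⟩ := h1
  obtain ⟨l, hl⟩ := h2
  have hkl : k ≠ l := by rintro rfl; omega
  have h3 : ∑ m ∈ {k, l}, |i m - j m| ≤ ∑ m, |i m - j m| :=
    Finset.sum_le_sum_of_subset_of_nonneg (Finset.subset_univ _) fun _ _ _ => abs_nonneg _
  rw [Finset.sum_pair hkl, show ∑ m, |i m - j m| = 1 from h] at h3
  have := abs_pos.2 (sub_ne_zero.2 (show i k ≠ j k by omega))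
  have := abs_pos.2 (sub_ne_zero.2 (show i l ≠ j l by omega))
  omega

theorem NearestNeighbor.symm {i j : Site d} (h : NearestNeighbor i j) : NearestNeighbor j i := by
  simpa only [NearestNeighbor, abs_sub_comm] using h

/-- Used to absorb the factor `β / 2`: for the interaction, the two orientations of an edge
contribute equally. -/
theorem sum_orientedEdges {M : Type*} [AddCommMonoid M] (F : Λ × Λ → M) :
    ∑ e ∈ orientedEdges Λ, F e = ∑ e : positiveEdges Λ, (F e.1 + F e.1.swap) := by
  classical
  have hunion : orientedEdges Λ = positiveEdges Λ ∪ (positiveEdges Λ).image Prod.swap := by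
    ext ⟨i, j⟩
    simp only [Finset.mem_union, Finset.mem_image, Prod.exists, Prod.swap_prod_mk, Prod.mk.injEq,
      positiveEdges, orientedEdges, Finset.mem_filter, Finset.mem_univ, true_and]
    constructor
    · intro h
      rcases h.le_or_le with h1 | h1
      · exact Or.inl ⟨h, h1⟩
      · exact Or.inr ⟨j, i, ⟨h.symm, h1⟩, rfl, rfl⟩
    · rintro (h | ⟨a, b, h, rfl, rfl⟩)
      · exact h.1
      · exact h.1.symm
  have hdisj : Disjoint (positiveEdges Λ) ((positiveEdges Λ).image Prod.swap) := by
    rw [Finset.disjoint_left]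
    rintro ⟨i, j⟩ h h'
    simp only [Finset.mem_image, Prod.exists, Prod.swap_prod_mk, Prod.mk.injEq] at h'
    obtain ⟨a, b, h', rfl, rfl⟩ := h'
    exact not_swap_mem_positiveEdges h h'
  rw [hunion, Finset.sum_union hdisj, Finset.sum_image (fun _ _ _ _ h => Prod.swap_injective h),
    ← Finset.sum_add_distrib, ← Finset.sum_coe_sort]

/-- The weight `e^{H(0)}` of the disorder `ξ`. -/
noncomputable def disorderWeight (Λ : Finset (Site d)) (β : ℝ) (h : Λ → ℝ)
    (ξ : (positiveEdges Λ → ℝ) × (Λ → ℝ)) : ℝ :=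
  Real.exp (β * ∑ e, Real.cos (ξ.1 e) + ∑ j, h j * Real.cos (ξ.2 j))

/-- The gauge action of a spin configuration on the disorder. -/
noncomputable def gaugeShift (Λ : Finset (Site d)) (θ : Λ → ℝ)
    (ξ : (positiveEdges Λ → ℝ) × (Λ → ℝ)) : (positiveEdges Λ → ℝ) × (Λ → ℝ) :=
  (fun e => toIcoMod Real.two_pi_pos (-Real.pi) (ξ.1 e + (θ e.1.1 - θ e.1.2)),
    fun j => toIcoMod Real.two_pi_pos (-Real.pi) (ξ.2 j + θ j))

/-- This is where the Nishimori line enters: the couplings `β` and `h` of the Gibbs weight coincide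
with the parameters of the disorder density. -/
theorem disorderWeight_gaugeShift (β : ℝ) (h : Λ → ℝ) (θ : Λ → ℝ)
    (ξ : (positiveEdges Λ → ℝ) × (Λ → ℝ)) :
    disorderWeight Λ β h (gaugeShift Λ θ ξ) =
      Real.exp (interaction Λ β h (oneForm Λ ξ.1) ξ.2 θ) := by
  simp only [disorderWeight, gaugeShift, cos_toIcoMod Real.two_pi_pos rfl, interaction,
    sum_orientedEdges]
  congr 2
  · have : ∀ e : positiveEdges Λ, Real.cos (θ e.1.1 - θ e.1.2 + oneForm Λ ξ.1 e.1.1 e.1.2) +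
        Real.cos (θ e.1.swap.1 - θ e.1.swap.2 + oneForm Λ ξ.1 e.1.swap.1 e.1.swap.2) =
        2 * Real.cos (ξ.1 e + (θ e.1.1 - θ e.1.2)) := by
      rintro ⟨⟨i, j⟩, he⟩
      have he' := not_swap_mem_positiveEdges he
      simp only [oneForm, he, he', Prod.swap, dite_true, dite_false]
      rw [← Real.cos_neg (θ j - θ i + _), two_mul]
      congr 2 <;> ring
    simp only [this, ← Finset.mul_sum]
    ring
  · simp only [add_comm]

theorem phaseNormalization_pos (u : ℝ) : 0 < phaseNormalization u := by
  by_contra hcon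
  have h := (phaseLaw_isProbabilityMeasure u).measure_univ
  have h0 : (phaseNormalization u)⁻¹ ≤ 0 := inv_nonpos.2 (not_lt.1 hcon)
  have : ∀ t, ENNReal.ofReal ((phaseNormalization u)⁻¹ * Real.exp (u * Real.cos t)) = 0 :=
    fun t => ENNReal.ofReal_of_nonpos (mul_nonpos_of_nonpos_of_nonneg h0 (Real.exp_pos _).le)
  simp [phaseLaw, this] at h

/-- Lebesgue measure on the box of disorders. -/
noncomputable def disorderBox (Λ : Finset (Site d)) :
    Measure ((positiveEdges Λ → ℝ) × (Λ → ℝ)) :=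
  (Measure.pi fun _ => volume.restrict (Ico (-Real.pi) (-Real.pi + 2 * Real.pi))).prod
    (Measure.pi fun _ => volume.restrict (Ico (-Real.pi) (-Real.pi + 2 * Real.pi)))

instance : IsFiniteMeasure (disorderBox Λ) := by
  unfold disorderBox; infer_instance

/-- The normalization of the disorder law. -/
noncomputable def disorderNormalization (Λ : Finset (Site d)) (β : ℝ) (h : Λ → ℝ) : ℝ :=
  (∏ _e : positiveEdges Λ, phaseNormalization β) * ∏ j, phaseNormalization (h j)

theorem disorderNormalization_pos (β : ℝ) (h : Λ → ℝ) : 0 < disorderNormalization Λ β h :=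
  mul_pos (Finset.prod_pos fun _ _ => phaseNormalization_pos _)
    (Finset.prod_pos fun _ _ => phaseNormalization_pos _)

theorem disorderLaw_eq (β : ℝ) (h : Λ → ℝ) :
    disorderLaw Λ β h = (disorderBox Λ).withDensity
      (fun ξ => ENNReal.ofReal ((disorderNormalization Λ β h)⁻¹ * disorderWeight Λ β h ξ)) := by
  have hpi : (-Real.pi + 2 * Real.pi) = Real.pi := by ring
  have key : ∀ {ι : Type} [Fintype ι] (u : ι → ℝ), Measure.pi (fun i => phaseLaw (u i)) =
      (Measure.pi fun _ => volume.restrict (Ico (-Real.pi) (-Real.pi + 2 * Real.pi))).withDensity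
        (fun x => ENNReal.ofReal
          (∏ i, ((phaseNormalization (u i))⁻¹ * Real.exp (u i * Real.cos (x i))))) := by
    intro ι _ u
    rw [hpi]
    have hp := fun i => phaseNormalization_pos (u i)
    refine pi_withDensity_ofReal (fun _ => volume.restrict (Ico (-Real.pi) Real.pi))
      (fun i t => (phaseNormalization (u i))⁻¹ * Real.exp (u i * Real.cos t))
      (fun i t => mul_nonneg (inv_nonneg.2 (hp i).le) (Real.exp_pos _).le) (fun i => ?_)
    refine Integrable.of_bound (Measurable.aestronglyMeasurable (by fun_prop))
      ((phaseNormalization (u i))⁻¹ * Real.exp |u i|) (ae_of_all _ fun t => ?_)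
    rw [Real.norm_eq_abs, abs_mul, abs_of_pos (inv_pos.2 (hp i)), abs_of_pos (Real.exp_pos _)]
    refine mul_le_mul_of_nonneg_left (Real.exp_le_exp.2 ?_) (inv_pos.2 (hp i)).le
    refine (le_abs_self _).trans ?_
    rw [abs_mul]
    exact mul_le_of_le_one_right (abs_nonneg _) (Real.abs_cos_le_one t)
  rw [disorderLaw, key, key, prod_withDensity (by fun_prop) (by fun_prop), disorderBox]
  congr 1
  funext ξ
  rw [← ENNReal.ofReal_mul]
  swap
  · exact Finset.prod_nonneg fun _ _ => mul_nonneg (inv_nonneg.2 (phaseNormalization_pos _).le)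
      (Real.exp_pos _).le
  congr 1
  rw [Finset.prod_mul_distrib, Finset.prod_mul_distrib, ← Real.exp_sum, ← Real.exp_sum,
    disorderNormalization, disorderWeight, Real.exp_add, Finset.prod_inv_distrib,
    Finset.prod_inv_distrib, mul_inv, Finset.mul_sum]
  ring

theorem measurable_disorderWeight (β : ℝ) (h : Λ → ℝ) : Measurable (disorderWeight Λ β h) := by
  unfold disorderWeight; fun_prop

theorem integral_disorderLaw (β : ℝ) (h : Λ → ℝ) (G : (positiveEdges Λ → ℝ) × (Λ → ℝ) → ℝ) :
    ∫ ξ, G ξ ∂(disorderLaw Λ β h) = (disorderNormalization Λ β h)⁻¹ *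
      ∫ ξ, G ξ * disorderWeight Λ β h ξ ∂(disorderBox Λ) := by
  have hC := disorderNormalization_pos β h
  rw [disorderLaw_eq, integral_withDensity_eq_integral_toReal_smul, ← integral_const_mul]
  · refine integral_congr_ae (ae_of_all _ fun ξ => ?_)
    simp only [smul_eq_mul]
    rw [ENNReal.toReal_ofReal (mul_nonneg (inv_pos.2 hC).le (show 0 ≤ disorderWeight Λ β h ξ from
      (Real.exp_pos _).le))]
    ring
  · exact ((measurable_disorderWeight β h).const_mul _).ennreal_ofReal
  · exact ae_of_all _ fun _ => ENNReal.ofReal_lt_top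

theorem measurePreserving_gaugeShift (φ : Λ → ℝ) :
    MeasurePreserving (gaugeShift Λ φ) (disorderBox Λ) (disorderBox Λ) :=
  (measurePreserving_pi _ _ fun e : positiveEdges Λ =>
    measurePreserving_toIcoMod_add Real.two_pi_pos (-Real.pi) (φ e.1.1 - φ e.1.2)).prod
  (measurePreserving_pi _ _ fun j : Λ =>
    measurePreserving_toIcoMod_add Real.two_pi_pos (-Real.pi) (φ j))

theorem volume_restrict_spins : (volume : Measure (Λ → ℝ)).restrict (spins Λ) =
    Measure.pi fun _ => volume.restrict (Ico 0 (0 + 2 * Real.pi)) := by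
  rw [spins, volume_pi, Measure.restrict_pi_pi, zero_add]

theorem measurable_gaugeShift : Measurable (Function.uncurry (gaugeShift Λ)) := by
  refine Measurable.prodMk (measurable_pi_lambda _ fun e => ?_) (measurable_pi_lambda _ fun j => ?_)
  · exact (measurable_toIcoMod _ _).comp (by fun_prop)
  · exact (measurable_toIcoMod _ _).comp (by fun_prop)

/-- Nishimori's gauge argument: an equivariant pair `(t₁, t₂)` bounds the averaged quenched
two-point function from below. -/
theorem two_mul_sub_le_averagedGibbs (β : ℝ) (h : Λ → ℝ) (x y : Λ)
    (t₁ t₂ : (positiveEdges Λ → ℝ) × (Λ → ℝ) → ℝ) (ht₁ : Measurable t₁) (ht₂ : Measurable t₂)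
    (K : ℝ) (hK₁ : ∀ ξ, |t₁ ξ| ≤ K) (hK₂ : ∀ ξ, |t₂ ξ| ≤ K)
    (ht₁g : ∀ θ ξ, t₁ (gaugeShift Λ θ ξ) =
      Real.cos (θ x - θ y) * t₁ ξ - Real.sin (θ x - θ y) * t₂ ξ)
    (ht₂g : ∀ θ ξ, t₂ (gaugeShift Λ θ ξ) =
      Real.sin (θ x - θ y) * t₁ ξ + Real.cos (θ x - θ y) * t₂ ξ) :
    2 * ∫ ξ, t₁ ξ ∂(disorderLaw Λ β h) - ∫ ξ, (t₁ ξ ^ 2 + t₂ ξ ^ 2) ∂(disorderLaw Λ β h) ≤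
      averagedGibbs Λ β h (fun θ => Real.cos (θ x - θ y)) := by
  set B : ℝ := |β| * Fintype.card (positiveEdges Λ) + ∑ j, |h j|
  have hB : ∀ ξ : (positiveEdges Λ → ℝ) × (Λ → ℝ),
      |β * ∑ e, Real.cos (ξ.1 e) + ∑ j, h j * Real.cos (ξ.2 j)| ≤ B := fun ξ => by
    refine (abs_add_le _ _).trans (add_le_add ?_ ?_)
    · rw [abs_mul]
      refine mul_le_mul_of_nonneg_left ?_ (abs_nonneg _)
      refine (Finset.abs_sum_le_sum_abs _ _).trans ?_
      refine (Finset.sum_le_sum fun e _ => Real.abs_cos_le_one _).trans ?_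
      simp
    · refine (Finset.abs_sum_le_sum_abs _ _).trans (Finset.sum_le_sum fun j _ => ?_)
      rw [abs_mul]
      exact mul_le_of_le_one_right (abs_nonneg _) (Real.abs_cos_le_one _)
  have key := gauge_lower_bound (disorderBox Λ)
    (Measure.pi fun _ : Λ => (volume : Measure ℝ).restrict (Ico 0 (0 + 2 * Real.pi))) (by
      intro h0
      have := congrArg (fun m : Measure (Λ → ℝ) => m univ) h0
      simp only [Measure.pi_univ, Measure.restrict_apply_univ, Real.volume_Ico,
        Measure.coe_zero, Pi.zero_apply, Finset.prod_const, zero_add, sub_zero] at this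
      exact (ENNReal.ofReal_pos.2 Real.two_pi_pos).ne' (eq_zero_of_pow_eq_zero this))
    (gaugeShift Λ) measurable_gaugeShift measurePreserving_gaugeShift
    (fun φ θ j => toIcoMod Real.two_pi_pos 0 (θ j + φ j))
    (fun φ => measurePreserving_pi _ _ fun j : Λ =>
      measurePreserving_toIcoMod_add Real.two_pi_pos 0 (φ j))
    (disorderWeight Λ β h) (measurable_disorderWeight β h) (Real.exp (-B)) (Real.exp B)
    (Real.exp_pos _) (fun ξ => Real.exp_le_exp.2 (abs_le.1 (hB ξ)).1)
    (fun ξ => Real.exp_le_exp.2 (abs_le.1 (hB ξ)).2)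
    (fun φ θ ξ => by
      -- The shifts compose only modulo `2π`; the integers below collect the discrepancies, which
      -- the cosine ignores.
      simp only [disorderWeight, gaugeShift, cos_toIcoMod Real.two_pi_pos rfl]
      refine congrArg Real.exp (congrArg₂ _ (congrArg _ (Finset.sum_congr rfl fun e _ => ?_))
        (Finset.sum_congr rfl fun j _ => congrArg _ ?_))
      · obtain ⟨k, hk⟩ := exists_toIcoMod_eq_add Real.two_pi_pos (-Real.pi)
          (ξ.1 e + (φ e.1.1 - φ e.1.2))
        obtain ⟨l, hl⟩ := exists_toIcoMod_eq_add Real.two_pi_pos 0 (θ e.1.1 + φ e.1.1)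
        obtain ⟨m, hm⟩ := exists_toIcoMod_eq_add Real.two_pi_pos 0 (θ e.1.2 + φ e.1.2)
        rw [hk, hl, hm, ← Real.cos_add_int_mul_two_pi _ (l - m - k)]
        congr 1
        push_cast
        ring
      · obtain ⟨k, hk⟩ := exists_toIcoMod_eq_add Real.two_pi_pos (-Real.pi) (ξ.2 j + φ j)
        obtain ⟨l, hl⟩ := exists_toIcoMod_eq_add Real.two_pi_pos 0 (θ j + φ j)
        rw [hk, hl, ← Real.cos_add_int_mul_two_pi _ (l - k)]
        congr 1
        push_cast
        ring)
    (fun θ => Real.cos (θ x - θ y)) (fun θ => Real.sin (θ x - θ y)) (by fun_prop) (by fun_prop)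
    (fun θ => Real.cos_sq_add_sin_sq _)
    (fun φ θ => by
      obtain ⟨l, hl⟩ := exists_toIcoMod_eq_add Real.two_pi_pos 0 (θ x + φ x)
      obtain ⟨m, hm⟩ := exists_toIcoMod_eq_add Real.two_pi_pos 0 (θ y + φ y)
      beta_reduce
      rw [hl, hm, ← Real.cos_add, ← Real.cos_add_int_mul_two_pi _ (m - l)]
      congr 1
      push_cast
      ring)
    (fun φ θ => by
      obtain ⟨l, hl⟩ := exists_toIcoMod_eq_add Real.two_pi_pos 0 (θ x + φ x)
      obtain ⟨m, hm⟩ := exists_toIcoMod_eq_add Real.two_pi_pos 0 (θ y + φ y)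
      beta_reduce
      rw [hl, hm, ← Real.sin_add, ← Real.sin_add_int_mul_two_pi _ (m - l)]
      congr 1
      push_cast
      ring) t₁ t₂ ht₁ ht₂ K hK₁ hK₂ ht₁g ht₂g
  have hC := disorderNormalization_pos β h
  simp only [disorderWeight_gaugeShift] at key
  rw [averagedGibbs, integral_disorderLaw, integral_disorderLaw, integral_disorderLaw]
  simp only [gibbs, partitionFunction, volume_restrict_spins]
  have := mul_le_mul_of_nonneg_left key (inv_pos.2 hC).le
  simp only [mul_comm (_ * _) (disorderWeight Λ β h _)]
  linarith

end NishimoriXY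

end

/-! ### Fourier coefficients of the phases and the second moment method. -/

section

open MeasureTheory Set

namespace NishimoriXY

theorem phaseLaw_integral (u : ℝ) (f : ℝ → ℝ) :
    ∫ t, f t ∂(phaseLaw u) = (phaseNormalization u)⁻¹ *
      ∫ t in (-Real.pi)..Real.pi, f t * Real.exp (u * Real.cos t) := by
  have hp := phaseNormalization_pos u
  rw [phaseLaw, integral_withDensity_eq_integral_toReal_smul (by fun_prop)
    (ae_of_all _ fun _ => ENNReal.ofReal_lt_top),
    intervalIntegral.integral_of_le (by linarith [Real.pi_pos]), ← integral_Ico_eq_integral_Ioc,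
    ← integral_const_mul]
  refine integral_congr_ae (ae_of_all _ fun t => ?_)
  simp only [smul_eq_mul]
  rw [ENNReal.toReal_ofReal (mul_nonneg (inv_pos.2 hp).le (Real.exp_pos _).le)]
  ring

theorem integral_phaseLaw_sin (u : ℝ) (k : ℤ) : ∫ t, Real.sin (k * t) ∂(phaseLaw u) = 0 := by
  rw [phaseLaw_integral]
  have h := intervalIntegral.integral_comp_neg (a := -Real.pi) (b := Real.pi)
    (fun t => Real.sin (k * t) * Real.exp (u * Real.cos t))
  simp only [mul_neg, Real.sin_neg, Real.cos_neg, neg_neg, neg_mul,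
    intervalIntegral.integral_neg] at h
  rw [show (∫ t in (-Real.pi)..Real.pi, Real.sin (k * t) * Real.exp (u * Real.cos t)) = 0 by
    linarith, mul_zero]

/-- The Fourier coefficients of the phase law. -/
noncomputable def phaseFourier (u : ℝ) (k : ℤ) : ℝ := ∫ t, Real.cos (k * t) ∂(phaseLaw u)

theorem phaseFourier_zero (u : ℝ) : phaseFourier u 0 = 1 := by simp [phaseFourier]

theorem phaseFourier_neg (u : ℝ) (k : ℤ) : phaseFourier u (-k) = phaseFourier u k := by
  simp [phaseFourier]

theorem abs_phaseFourier_le_one (u : ℝ) (k : ℤ) : |phaseFourier u k| ≤ 1 := by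
  have := norm_integral_le_of_norm_le_const (μ := phaseLaw u) (f := fun t => Real.cos (k * t))
    (ae_of_all _ fun t => Real.abs_cos_le_one _)
  simpa [phaseFourier] using this

/-- Complex characters factor over independent coordinates, and each factor is real because the
phase law is even. -/
theorem integral_pi_phaseLaw_exp {ι : Type*} [Fintype ι] (u : ℝ) (k : ι → ℤ) :
    ∫ η, Complex.exp ((∑ i, k i * η i : ℝ) * Complex.I) ∂(Measure.pi fun _ : ι => phaseLaw u) =
      ((∏ i, phaseFourier u (k i) : ℝ) : ℂ) := by
  have h1 : ∀ η : ι → ℝ, Complex.exp ((∑ i, k i * η i : ℝ) * Complex.I) =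
      ∏ i, Complex.exp ((k i * η i : ℝ) * Complex.I) := fun η => by
    rw [← Complex.exp_sum]
    push_cast
    rw [Finset.sum_mul]
  simp only [h1]
  rw [integral_fintype_prod_eq_prod (fun i t => Complex.exp ((k i * t : ℝ) * Complex.I))]
  rw [Complex.ofReal_prod]
  refine Finset.prod_congr rfl fun i _ => ?_
  have hi : Integrable (fun t : ℝ => Complex.exp ((k i * t : ℝ) * Complex.I)) (phaseLaw u) := by
    refine Integrable.of_bound (Measurable.aestronglyMeasurable (by fun_prop)) 1
      (ae_of_all _ fun t => ?_)
    rw [Complex.norm_exp_ofReal_mul_I]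
  apply Complex.ext
  · rw [← RCLike.re_eq_complex_re, ← integral_re hi]
    simp only [RCLike.re_eq_complex_re, Complex.exp_ofReal_mul_I_re, Complex.ofReal_re]
    rfl
  · rw [← RCLike.im_eq_complex_im, ← integral_im hi]
    simp only [RCLike.im_eq_complex_im, Complex.exp_ofReal_mul_I_im, Complex.ofReal_im]
    exact integral_phaseLaw_sin u (k i)

theorem integral_pi_phaseLaw_cos {ι : Type*} [Fintype ι] (u : ℝ) (k : ι → ℤ) :
    ∫ η, Real.cos (∑ i, k i * η i) ∂(Measure.pi fun _ : ι => phaseLaw u) =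
      ∏ i, phaseFourier u (k i) := by
  have hi : Integrable (fun η : ι → ℝ => Complex.exp ((∑ i, k i * η i : ℝ) * Complex.I))
      (Measure.pi fun _ : ι => phaseLaw u) := by
    refine Integrable.of_bound (Measurable.aestronglyMeasurable (by fun_prop)) 1
      (ae_of_all _ fun t => ?_)
    rw [Complex.norm_exp_ofReal_mul_I]
  have h := congrArg Complex.re (integral_pi_phaseLaw_exp u k)
  rw [← RCLike.re_eq_complex_re, ← integral_re hi] at h
  simpa only [RCLike.re_eq_complex_re, Complex.exp_ofReal_mul_I_re, Complex.ofReal_re] using h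

variable {d : ℕ} {Λ : Finset (Site d)}

theorem integral_disorderLaw_cos (β : ℝ) (h : Λ → ℝ) (k : positiveEdges Λ → ℤ) :
    ∫ ξ, Real.cos (∑ e, k e * ξ.1 e) ∂(disorderLaw Λ β h) = ∏ e, phaseFourier β (k e) := by
  rw [← integral_pi_phaseLaw_cos, disorderLaw]
  have := (measurePreserving_fst (μ := Measure.pi fun _ : positiveEdges Λ => phaseLaw β)
    (ν := Measure.pi fun j : Λ => phaseLaw (h j)))
  conv_rhs => rw [← this.map_eq]
  exact (integral_map this.measurable.aemeasurable (f := fun η => Real.cos (∑ e, k e * η e))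
    (Measurable.aestronglyMeasurable (by fun_prop))).symm

/-- Second moment bound: a finite family of unit flows from `x` to `y` with values in `{-1, 0, 1}`
bounds the averaged quenched two-point function through the number of common edges of two
flows chosen uniformly at random. -/
theorem second_moment_le_averagedGibbs (β : ℝ) (h : Λ → ℝ) (x y : Λ)
    (hc : 0 < phaseFourier β 1) {ι : Type*} [Fintype ι] [Nonempty ι]
    (n : ι → positiveEdges Λ → ℤ) (hn : ∀ p e, |n p e| ≤ 1)
    (hflow : ∀ p (f : Λ → ℝ), ∑ e, n p e * (f e.1.1 - f e.1.2) = f x - f y) :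
    2 - (∑ p, ∑ q, ((phaseFourier β 1)⁻¹ ^ 2) ^
        (Finset.univ.filter fun e => n p e ≠ 0 ∧ n q e ≠ 0).card) / (Fintype.card ι : ℝ) ^ 2 ≤
      averagedGibbs Λ β h (fun θ => Real.cos (θ x - θ y)) := by
  set c := phaseFourier β 1 with hcdef
  set N : ℝ := (Fintype.card ι : ℝ) with hN
  have hNpos : 0 < N := by rw [hN]; exact_mod_cast Fintype.card_pos
  -- The mean phase along a flow is `c` to the number of its edges. Dividing by it makes every flow
  -- an unbiased estimator of `1`.
  set κ : ι → ℝ := fun p => N⁻¹ * ∏ e, c⁻¹ ^ (n p e).natAbs with hκ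
  have hκpos : ∀ p, 0 ≤ κ p := fun p =>
    mul_nonneg (inv_pos.2 hNpos).le (Finset.prod_nonneg fun _ _ => pow_nonneg (inv_pos.2 hc).le _)
  let t₁ : (positiveEdges Λ → ℝ) × (Λ → ℝ) → ℝ := fun ξ => ∑ p, κ p * Real.cos (∑ e, n p e * ξ.1 e)
  let t₂ : (positiveEdges Λ → ℝ) × (Λ → ℝ) → ℝ := fun ξ => ∑ p, κ p * Real.sin (∑ e, n p e * ξ.1 e)
  have hF : ∀ k : ℤ, |k| ≤ 1 → phaseFourier β k = c ^ k.natAbs := fun k hk => by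
    have : k = -1 ∨ k = 0 ∨ k = 1 := by
      have := abs_le.1 hk; omega
    rcases this with rfl | rfl | rfl
    · simp [phaseFourier_neg, hcdef]
    · simp [phaseFourier_zero]
    · simp [hcdef]
  have hshift : ∀ p θ ξ,
      Real.cos (∑ e, n p e * (gaugeShift Λ θ ξ).1 e) =
        Real.cos ((θ x - θ y) + ∑ e, n p e * ξ.1 e) ∧
      Real.sin (∑ e, n p e * (gaugeShift Λ θ ξ).1 e) =
        Real.sin ((θ x - θ y) + ∑ e, n p e * ξ.1 e) := fun p θ ξ => by
    have := cos_sin_sum_eq_of_congr (n p) (gaugeShift Λ θ ξ).1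
      (fun e => ξ.1 e + (θ e.1.1 - θ e.1.2)) fun e => exists_toIcoMod_eq_add _ _ _
    simp only [mul_add, Finset.sum_add_distrib] at this
    -- The shifts along a unit flow sum to `θ x - θ y`, which is the equivariance required of the
    -- estimator.
    rw [hflow p θ] at this
    rwa [add_comm (θ x - θ y)]
  have hbound : ∀ (F : ℝ → ℝ), (∀ t, |F t| ≤ 1) → ∀ ξ : (positiveEdges Λ → ℝ) × (Λ → ℝ),
      |∑ p, κ p * F (∑ e, n p e * ξ.1 e)| ≤ ∑ p, κ p := fun F hF ξ => by
    refine (Finset.abs_sum_le_sum_abs _ _).trans (Finset.sum_le_sum fun p _ => ?_)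
    rw [abs_mul, abs_of_nonneg (hκpos p)]
    exact mul_le_of_le_one_right (hκpos p) (hF _)
  have key := two_mul_sub_le_averagedGibbs β h x y t₁ t₂ (by fun_prop) (by fun_prop) (∑ p, κ p)
    (hbound Real.cos Real.abs_cos_le_one) (hbound Real.sin Real.abs_sin_le_one)
    (fun θ ξ => by
      simp only [t₁, t₂, hshift, Real.cos_add, Finset.mul_sum, ← Finset.sum_sub_distrib]
      exact Finset.sum_congr rfl fun p _ => by ring)
    (fun θ ξ => by
      simp only [t₁, t₂, hshift, Real.sin_add, Finset.mul_sum, ← Finset.sum_add_distrib]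
      exact Finset.sum_congr rfl fun p _ => by ring)
  have : IsProbabilityMeasure (disorderLaw Λ β h) := by unfold disorderLaw; infer_instance
  have hint : ∀ k : positiveEdges Λ → ℤ, Integrable
      (fun ξ : (positiveEdges Λ → ℝ) × (Λ → ℝ) => Real.cos (∑ e, k e * ξ.1 e))
      (disorderLaw Λ β h) := fun k =>
    Integrable.of_bound (Measurable.aestronglyMeasurable (by fun_prop)) 1
      (ae_of_all _ fun _ => Real.abs_cos_le_one _)
  have hT1 : ∫ ξ, t₁ ξ ∂(disorderLaw Λ β h) = 1 := by
    simp only [t₁]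
    rw [integral_finsetSum _ fun p _ => (hint _).const_mul _]
    simp only [integral_const_mul, integral_disorderLaw_cos]
    have : ∀ p, κ p * ∏ e, phaseFourier β (n p e) = N⁻¹ := fun p => by
      rw [hκ, mul_assoc, ← Finset.prod_mul_distrib, Finset.prod_eq_one, mul_one]
      intro e _
      rw [hF _ (hn p e), ← mul_pow, inv_mul_cancel₀ hc.ne', one_pow]
    simp only [this, Finset.sum_const, Finset.card_univ, nsmul_eq_mul]
    exact mul_inv_cancel₀ hNpos.ne'
  have hT2 : ∫ ξ, (t₁ ξ ^ 2 + t₂ ξ ^ 2) ∂(disorderLaw Λ β h) =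
      ∑ p, ∑ q, κ p * κ q * ∏ e, phaseFourier β (n p e - n q e) := by
    have h1 : ∀ ξ, t₁ ξ ^ 2 + t₂ ξ ^ 2 = ∑ p, ∑ q, κ p * κ q *
        Real.cos (∑ e, ((n p e - n q e : ℤ) : ℝ) * ξ.1 e) := fun ξ => by
      simp only [t₁, t₂, sq, Finset.sum_mul_sum, ← Finset.sum_add_distrib]
      refine Finset.sum_congr rfl fun p _ => Finset.sum_congr rfl fun q _ => ?_
      have : ∑ e, ((n p e - n q e : ℤ) : ℝ) * ξ.1 e =
          ∑ e, n p e * ξ.1 e - ∑ e, n q e * ξ.1 e := by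
        rw [← Finset.sum_sub_distrib]
        exact Finset.sum_congr rfl fun e _ => by push_cast; ring
      rw [this, Real.cos_sub]
      ring
    simp only [h1]
    rw [integral_finsetSum _ fun p _ => integrable_finsetSum _ fun q _ => (hint _).const_mul _]
    refine Finset.sum_congr rfl fun p _ => ?_
    rw [integral_finsetSum _ fun q _ => (hint _).const_mul _]
    exact Finset.sum_congr rfl fun q _ => by
      rw [integral_const_mul, integral_disorderLaw_cos β h (fun e => n p e - n q e)]
  rw [hT1, hT2] at key
  refine le_trans ?_ key
  rw [mul_one, Finset.sum_div]
  refine sub_le_sub_left (Finset.sum_le_sum fun p _ => ?_) _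
  rw [Finset.sum_div]
  refine Finset.sum_le_sum fun q _ => ?_
  have hc1 : c ≤ 1 := (le_abs_self _).trans (abs_phaseFourier_le_one β 1)
  have hci : 1 ≤ c⁻¹ := (one_le_inv₀ hc).2 hc1
  -- An edge used by only one flow contributes exactly `1`. A common edge contributes at most `c⁻¹ ^
  -- 2`, whether it is crossed in equal or opposite directions.
  have hprod : ∏ e, (c⁻¹ ^ (n p e).natAbs * c⁻¹ ^ (n q e).natAbs * phaseFourier β (n p e - n q e)) ≤
      ∏ e, (if n p e ≠ 0 ∧ n q e ≠ 0 then c⁻¹ ^ 2 else 1) := by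
    refine (le_abs_self _).trans ?_
    rw [Finset.abs_prod]
    refine Finset.prod_le_prod (fun _ _ => abs_nonneg _) fun e _ => ?_
    have hle := abs_phaseFourier_le_one β (n p e - n q e)
    have hcases : ∀ k : ℤ, |k| ≤ 1 → k = 0 ∨ k.natAbs = 1 := fun k hk => by
      have := abs_le.1 hk; omega
    have hself : ∀ k : ℤ, |k| ≤ 1 → |c⁻¹ ^ k.natAbs * phaseFourier β k| ≤ 1 := fun k hk => by
      rw [hF k hk, ← mul_pow, inv_mul_cancel₀ hc.ne', one_pow, abs_one]
    by_cases hp : n p e = 0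
    · simpa [hp, phaseFourier_neg] using hself _ (hn q e)
    by_cases hq : n q e = 0
    · simpa [hq] using hself _ (hn p e)
    rw [if_pos ⟨hp, hq⟩, ((hcases _ (hn p e)).resolve_left hp),
      ((hcases _ (hn q e)).resolve_left hq), pow_one, ← sq, abs_mul,
      abs_of_nonneg (sq_nonneg _)]
    exact mul_le_of_le_one_right (sq_nonneg _) hle
  rw [Finset.prod_ite, Finset.prod_const_one, mul_one, Finset.prod_const] at hprod
  rw [le_div_iff₀ (by positivity)]
  refine le_trans (le_of_eq ?_) hprod
  rw [Finset.prod_mul_distrib, Finset.prod_mul_distrib, hκ]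
  field_simp

end NishimoriXY

end

/-! ### The first Fourier coefficient at large `β`. -/

section

open MeasureTheory Set

namespace NishimoriXY

/-- Laplace's method: on `|t| ≤ 1 / √β` the exponent `β cos t` is at least `β - 1 / 2`. -/
theorem phaseNormalization_lower {β : ℝ} (hβ : 1 ≤ β) :
    Real.exp (β - 1 / 2) * (2 / Real.sqrt β) ≤ phaseNormalization β := by
  have h1 : 1 ≤ Real.sqrt β := Real.one_le_sqrt.2 hβ
  have hr : (Real.sqrt β)⁻¹ ≤ 1 := inv_le_one_of_one_le₀ h1
  have hr0 : 0 < (Real.sqrt β)⁻¹ := by positivity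
  have hpi := Real.pi_gt_three
  have hint : IntegrableOn (fun t => Real.exp (β * Real.cos t)) (Ico (-Real.pi) Real.pi) :=
    ((Continuous.continuousOn (by fun_prop)).integrableOn_compact
      (K := Icc (-Real.pi) Real.pi) isCompact_Icc).mono_set Ico_subset_Icc_self
  have hsub : Icc (-(Real.sqrt β)⁻¹) (Real.sqrt β)⁻¹ ⊆ Ico (-Real.pi) Real.pi := fun t ht =>
    ⟨by linarith [ht.1], by linarith [ht.2]⟩
  have h2 : ∫ _t in Icc (-(Real.sqrt β)⁻¹) (Real.sqrt β)⁻¹, Real.exp (β - 1 / 2) ≤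
      ∫ t in Icc (-(Real.sqrt β)⁻¹) (Real.sqrt β)⁻¹, Real.exp (β * Real.cos t) := by
    refine setIntegral_mono_on (integrable_const _) (hint.mono_set hsub) measurableSet_Icc
      fun t ht => Real.exp_le_exp.2 ?_
    have h3 := Real.one_sub_sq_div_two_le_cos (x := t)
    have h4 : t ^ 2 ≤ (Real.sqrt β)⁻¹ ^ 2 := sq_le_sq' ht.1 ht.2
    rw [inv_pow, Real.sq_sqrt (by linarith)] at h4
    have h5 : β * t ^ 2 ≤ 1 := by
      have := mul_le_mul_of_nonneg_left h4 (by linarith : 0 ≤ β)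
      rwa [mul_inv_cancel₀ (by linarith)] at this
    nlinarith
  have h3 := setIntegral_mono_set hint (ae_of_all _ fun t => (Real.exp_pos _).le)
    hsub.eventuallyLE
  rw [setIntegral_const, smul_eq_mul, measureReal_def, Real.volume_Icc,
    ENNReal.toReal_ofReal (by linarith)] at h2
  calc Real.exp (β - 1 / 2) * (2 / Real.sqrt β)
      = ((Real.sqrt β)⁻¹ - -(Real.sqrt β)⁻¹) * Real.exp (β - 1 / 2) := by ring
    _ ≤ _ := h2.trans h3

/-- Gibbs' inequality for the phase law against the uniform law. -/
theorem log_phaseNormalization_le (β : ℝ) :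
    Real.log (phaseNormalization β / (2 * Real.pi)) ≤ β * phaseFourier β 1 := by
  have hZ := phaseNormalization_pos β
  set L := Real.log (phaseNormalization β / (2 * Real.pi)) with hL
  have hexp : ∫ t, Real.exp (L - β * Real.cos t) ∂(phaseLaw β) = 1 := by
    rw [phaseLaw_integral]
    have : ∀ t, Real.exp (L - β * Real.cos t) * Real.exp (β * Real.cos t) = Real.exp L :=
      fun t => by rw [← Real.exp_add]; congr 1; ring
    simp only [this, intervalIntegral.integral_const, smul_eq_mul]
    rw [hL, Real.exp_log (by have := Real.pi_pos; positivity)]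
    have := Real.pi_pos
    field_simp
    ring
  have hcos : Integrable (fun t => Real.cos t) (phaseLaw β) :=
    Integrable.of_bound (Measurable.aestronglyMeasurable (by fun_prop)) 1
      (ae_of_all _ fun _ => Real.abs_cos_le_one _)
  have hle : ∫ t, (1 + L - β * Real.cos t) ∂(phaseLaw β) ≤
      ∫ t, Real.exp (L - β * Real.cos t) ∂(phaseLaw β) := by
    refine integral_mono ((integrable_const _).sub (hcos.const_mul β)) ?_ fun t => ?_
    · by_contra hcon
      rw [integral_undef hcon] at hexp
      norm_num at hexp
    · have := Real.add_one_le_exp (L - β * Real.cos t)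
      simp only
      linarith
  rw [hexp, integral_sub (integrable_const _) (hcos.const_mul β), integral_const_mul] at hle
  simp only [integral_const, probReal_univ, one_smul] at hle
  have : phaseFourier β 1 = ∫ t, Real.cos t ∂(phaseLaw β) := by simp [phaseFourier]
  rw [this]
  linarith

/-- Gibbs' inequality and the Laplace bound give `β (1 - c) ≤ 1 / 2 + log β / 2 + log π`. The
constants are absorbed because `log β ≥ 1` for `β ≥ 3`. -/
theorem one_sub_phaseFourier_le {β : ℝ} (hβ : 3 ≤ β) :
    1 - phaseFourier β 1 ≤ 4 * (Real.log β / β) := by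
  have hb : 0 < β := by linarith
  have hpi := Real.pi_pos
  have h1 : 1 ≤ Real.log β := by
    rw [Real.le_log_iff_exp_le hb]
    linarith [Real.exp_one_lt_d9]
  have h2 : Real.log (Real.exp (β - 1 / 2) * (2 / Real.sqrt β) / (2 * Real.pi)) ≤
      β * phaseFourier β 1 := by
    refine le_trans (Real.log_le_log (by positivity) ?_) (log_phaseNormalization_le β)
    gcongr
    exact phaseNormalization_lower (by linarith)
  have h3 : Real.log (Real.exp (β - 1 / 2) * (2 / Real.sqrt β) / (2 * Real.pi)) =
      β - 1 / 2 - Real.log β / 2 - Real.log Real.pi := by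
    rw [show Real.exp (β - 1 / 2) * (2 / Real.sqrt β) / (2 * Real.pi) =
      Real.exp (β - 1 / 2) / Real.sqrt β / Real.pi by field_simp, Real.log_div (by positivity)
      (by positivity), Real.log_div (by positivity) (by positivity), Real.log_exp,
      Real.log_sqrt hb.le]
  have h4 : Real.log Real.pi ≤ Real.pi - 1 := Real.log_le_sub_one_of_pos hpi
  have h5 := Real.pi_lt_d2
  have h6 : β * (1 - phaseFourier β 1) ≤ 4 * Real.log β := by nlinarith
  rw [← mul_div_assoc, le_div_iff₀ hb]
  linarith

end NishimoriXY

end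

/-! ### A renewal inequality, resampling, and the multiscale staircase. -/

section

open Finset

/-- A telescoping expansion according to the last selected factor; it produces the renewal structure
for near-collisions. -/
theorem Finset.prod_one_add_eq_sum (r : ℝ) (f : ℕ → ℝ) (n : ℕ) :
    ∏ s ∈ range n, (1 + r * f s) = 1 + r * ∑ t ∈ range n, f t * ∏ s ∈ range t, (1 + r * f s) := by
  induction n with
  | zero => simp
  | succ n ih =>
    rw [prod_range_succ, sum_range_succ, mul_add r, ← add_assoc, ← ih]
    ring

/-- A discrete renewal inequality. -/
theorem sum_le_of_renewal {a g : ℕ → ℝ} {r G : ℝ} {n : ℕ} (ha : ∀ t, 0 ≤ a t)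
    (hr : 0 ≤ r) (hG : ∀ m, ∑ k ∈ range m, g k ≤ G) (hg : ∀ k, 0 ≤ g k)
    (hrec : ∀ t < n, a t ≤ g t + r * ∑ s ∈ range t, g (t - s) * a s) :
    (1 - r * G) * ∑ t ∈ range n, a t ≤ G := by
  have h1 : ∑ t ∈ range n, ∑ s ∈ range t, g (t - s) * a s ≤ G * ∑ s ∈ range n, a s := by
    -- For fixed `s` the lags `t - s` are distinct, so their total profile is at most `G`.
    rw [sum_comm' (t' := range n) (s' := fun s => Ico (s + 1) n)
      (h := fun t s => by simp only [mem_range, mem_Ico]; omega), mul_sum]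
    refine sum_le_sum fun s _ => ?_
    rw [← sum_mul]
    refine mul_le_mul_of_nonneg_right (le_trans ?_ (hG n)) (ha s)
    have : ∑ t ∈ Ico (s + 1) n, g (t - s) = ∑ k ∈ (Ico (s + 1) n).image (fun t => t - s), g k := by
      rw [sum_image]
      intro x hx y hy hxy
      simp only [coe_Ico, Set.mem_Ico] at hx hy
      simp only at hxy
      omega
    rw [this]
    refine sum_le_sum_of_subset_of_nonneg (fun k hk => ?_) fun k _ _ => hg k
    simp only [mem_image, mem_Ico] at hk
    obtain ⟨t, ht, rfl⟩ := hk
    simp only [mem_range]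
    omega
  have h2 : ∑ t ∈ range n, a t ≤ ∑ t ∈ range n, (g t + r * ∑ s ∈ range t, g (t - s) * a s) :=
    sum_le_sum fun t ht => hrec t (mem_range.1 ht)
  rw [sum_add_distrib, ← mul_sum] at h2
  have := hG n
  have := mul_le_mul_of_nonneg_left h1 hr
  nlinarith

/-- Resampling one coordinate preserves the uniform law, since exchanging the old and the new value
is an involution. -/
theorem sum_sum_update {ι : Type*} [Fintype ι] [DecidableEq ι] {κ : ι → Type*}
    [∀ i, Fintype (κ i)] (b : ι) (F : (∀ i, κ i) → ℝ) :
    ∑ U, ∑ u, F (Function.update U b u) = Fintype.card (κ b) * ∑ U, F U := by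
  let e : ((∀ i, κ i) × κ b) → ((∀ i, κ i) × κ b) := fun p => (Function.update p.1 b p.2, p.1 b)
  have he : Function.Involutive e := fun p => by simp [e]
  rw [← Fintype.sum_prod_type' (f := fun U u => F (Function.update U b u)),
    Fintype.sum_bijective e he.bijective (fun p : (∀ i, κ i) × κ b => F (Function.update p.1 b p.2))
      (fun p : (∀ i, κ i) × κ b => F p.1) (fun p => rfl), Fintype.sum_prod_type]
  simp [mul_sum]

namespace MultiscaleWalk

/-- The step at time `s`: only the scale `j` with `2 ^ j ∥ s` moves, and it moves during the first
`V j m` of its active times in the block `[m 8 ^ j, (m + 1) 8 ^ j)`. -/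
def step (V : ℕ → ℕ → ℕ) (s : ℕ) : ℕ :=
  if s % 8 ^ padicValNat 2 s <
    2 ^ (padicValNat 2 s + 1) * V (padicValNat 2 s) (s / 8 ^ padicValNat 2 s) then 1 else 0

/-- The position at time `t`. -/
def pos (V : ℕ → ℕ → ℕ) (t : ℕ) : ℕ := ∑ s ∈ range t, step V s

theorem pos_succ (V : ℕ → ℕ → ℕ) (t : ℕ) :
    pos V (t + 1) = pos V t ∨ pos V (t + 1) = pos V t + 1 := by
  rw [pos, sum_range_succ, ← pos, step]
  split_ifs <;> simp

theorem pos_le_self (V : ℕ → ℕ → ℕ) (t : ℕ) : pos V t ≤ t := by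
  induction t with
  | zero => simp [pos]
  | succ t ih => rcases pos_succ V t with h | h <;> omega

/-- The displacement `V j m` acts only from time `m * 8 ^ j` on, so the earlier walk is independent
of it. -/
theorem pos_congr {V V' : ℕ → ℕ → ℕ} {j m t : ℕ}
    (h : ∀ j' m', (j', m') ≠ (j, m) → V j' m' = V' j' m') (ht : t ≤ m * 8 ^ j) :
    pos V t = pos V' t := by
  refine sum_congr rfl fun s hs => ?_
  rw [mem_range] at hs
  rw [step, step, h]
  rintro heq
  rw [Prod.mk.injEq] at heq
  obtain ⟨h1, h2⟩ := heq
  rw [h1] at h2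
  have := Nat.div_mul_le_self s (8 ^ j)
  rw [h2] at this
  omega

theorem padicValNat_two_pow_mul_odd (j q : ℕ) (hq : q % 2 = 1) :
    padicValNat 2 (2 ^ j * q) = j := by
  have hq0 : q ≠ 0 := by rintro rfl; simp at hq
  rw [padicValNat.mul (by positivity) hq0, padicValNat.prime_pow,
    padicValNat.eq_zero_of_not_dvd (by omega), add_zero]

/-- For `j > 0`, the active times are the odd multiples of `2 ^ j`. A block contains `8 ^ j / 2 ^ (j
+ 1) = 4 ^ j / 2` of them, hence the bound on `u`. -/
theorem card_active {j m t u : ℕ} (hu : u ≤ 4 ^ j / 2) (ht : (m + 1) * 8 ^ j ≤ t) :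
    ((range t).filter fun s => (padicValNat 2 s = j ∧ s / 8 ^ j = m) ∧
      s % 8 ^ j < 2 ^ (j + 1) * u).card = u := by
  have h8 : 8 ^ j = 2 ^ j * 4 ^ j := by rw [← Nat.mul_pow]
  have h2 : 0 < 2 ^ j := by positivity
  rcases Nat.eq_zero_or_pos u with rfl | hupos
  · simp
  have hj : 4 ^ j % 2 = 0 := by
    rcases Nat.eq_zero_or_pos j with rfl | hj
    · simp at hu; omega
    · obtain ⟨i, rfl⟩ := Nat.exists_eq_add_of_lt hj
      rw [zero_add, pow_succ]; omega
  have : (range t).filter (fun s => (padicValNat 2 s = j ∧ s / 8 ^ j = m) ∧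
      s % 8 ^ j < 2 ^ (j + 1) * u) =
      (range u).image fun r => 2 ^ j * (m * 4 ^ j + (2 * r + 1)) := by
    ext s
    simp only [mem_filter, mem_range, mem_image]
    constructor
    · rintro ⟨hst, ⟨hv, hm⟩, hlt⟩
      -- Time `0` has `padicValNat 2 0 = 0` by convention and would belong to scale `0`, where the
      -- bound on `u` allows no displacement.
      have hs0 : s ≠ 0 := by
        rintro rfl
        simp only [padicValNat_zero_right] at hv
        subst hv
        simp at hu
        omega
      have hdvd : 2 ^ j ∣ s := hv ▸ pow_padicValNat_dvd
      obtain ⟨q, rfl⟩ := hdvd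
      have hodd : q % 2 = 1 := by
        by_contra hcon
        have : 2 ^ (j + 1) ∣ 2 ^ j * q := by
          rw [pow_succ]
          exact Nat.mul_dvd_mul_left _ (by omega)
        rw [← hv] at this
        exact pow_succ_padicValNat_not_dvd hs0 (by rwa [hv] at this ⊢)
      rw [h8, Nat.mul_mod_mul_left, pow_succ, mul_assoc] at hlt
      have hlt' := Nat.lt_of_mul_lt_mul_left hlt
      rw [h8, Nat.mul_div_mul_left _ _ h2] at hm
      have hq := Nat.div_add_mod q (4 ^ j)
      rw [hm] at hq
      have hmod : (q % 4 ^ j) % 2 = 1 := by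
        rw [Nat.mod_mod_of_dvd _ (Nat.dvd_of_mod_eq_zero hj)]; exact hodd
      refine ⟨(q % 4 ^ j) / 2, by omega, ?_⟩
      congr 1
      rw [mul_comm m]
      omega
    · rintro ⟨r, hr, rfl⟩
      have hlt : 2 * r + 1 < 4 ^ j := by omega
      have hdiv : 2 ^ j * (m * 4 ^ j + (2 * r + 1)) / 8 ^ j = m := by
        rw [h8, Nat.mul_div_mul_left _ _ h2, mul_comm m, Nat.mul_add_div (by positivity),
          Nat.div_eq_of_lt hlt, add_zero]
      have hmod : 2 ^ j * (m * 4 ^ j + (2 * r + 1)) % 8 ^ j = 2 ^ j * (2 * r + 1) := by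
        rw [h8, Nat.mul_mod_mul_left, mul_comm m, Nat.mul_add_mod, Nat.mod_eq_of_lt hlt]
      refine ⟨?_, ⟨padicValNat_two_pow_mul_odd _ _ ?_, hdiv⟩, ?_⟩
      · refine lt_of_lt_of_le ?_ ht
        rw [h8]
        nlinarith
      · have : (m * 4 ^ j) % 2 = 0 := by rw [Nat.mul_mod, hj]; simp
        omega
      · rw [hmod, pow_succ, mul_assoc]
        exact Nat.mul_lt_mul_of_pos_left (by omega) h2
  rw [this, card_image_of_injective, card_range]
  intro r r' h
  have := Nat.eq_of_mul_eq_mul_left h2 h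
  omega

/-- Distinct blocks act at disjoint times, so after its end a block contributes its displacement
additively, whatever the others do. -/
theorem pos_eq_add {V V' : ℕ → ℕ → ℕ} {j m t : ℕ}
    (h : ∀ j' m', (j', m') ≠ (j, m) → V j' m' = V' j' m') (h0 : V' j m = 0)
    (hu : V j m ≤ 4 ^ j / 2) (ht : (m + 1) * 8 ^ j ≤ t) : pos V t = pos V' t + V j m := by
  conv_rhs => rw [← card_active hu ht, card_filter, pos, ← sum_add_distrib]
  refine sum_congr rfl fun s _ => ?_
  by_cases hs : padicValNat 2 s = j ∧ s / 8 ^ j = m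
  · obtain ⟨h1, h2⟩ := hs
    simp [step, h1, h2, h0]
  · rw [step, step, h, if_neg (c := _ ∧ _) (fun hh => hs hh.1), add_zero]
    intro heq
    rw [Prod.mk.injEq] at heq
    obtain ⟨h1, h2⟩ := heq
    rw [h1] at h2
    exact hs ⟨h1, h2⟩

end MultiscaleWalk

end

/-! ### Exponential moments of the near-collisions of the random staircases. -/

section

open Finset

namespace MultiscaleWalk

/-- A pair of random displacements for every block `(j, m)` of the first `n` scales. -/
abbrev Choice (n : ℕ) : Type :=
  (b : Fin n × Fin n) → Fin (4 ^ (b.1 : ℕ) / 2 + 1) × Fin (4 ^ (b.1 : ℕ) / 2 + 1)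

/-- The first coordinates of a choice. -/
def fstChoice {n : ℕ} (U : Choice n) (j m : ℕ) : ℕ :=
  if h : j < n ∧ m < n then (U (⟨j, h.1⟩, ⟨m, h.2⟩)).1 else 0

/-- The second coordinates of a choice. -/
def sndChoice {n : ℕ} (U : Choice n) (j m : ℕ) : ℕ :=
  if h : j < n ∧ m < n then (U (⟨j, h.1⟩, ⟨m, h.2⟩)).2 else 0

theorem fstChoice_update_of_ne {n : ℕ} (U : Choice n) (b : Fin n × Fin n)
    (u : Fin (4 ^ (b.1 : ℕ) / 2 + 1) × Fin (4 ^ (b.1 : ℕ) / 2 + 1)) {j m : ℕ}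
    (h : (j, m) ≠ ((b.1 : ℕ), (b.2 : ℕ))) :
    fstChoice (Function.update U b u) j m = fstChoice U j m := by
  unfold fstChoice
  split_ifs with hjm
  · rw [Function.update_of_ne]
    rintro rfl
    exact h rfl
  · rfl

theorem sndChoice_update_of_ne {n : ℕ} (U : Choice n) (b : Fin n × Fin n)
    (u : Fin (4 ^ (b.1 : ℕ) / 2 + 1) × Fin (4 ^ (b.1 : ℕ) / 2 + 1)) {j m : ℕ}
    (h : (j, m) ≠ ((b.1 : ℕ), (b.2 : ℕ))) :
    sndChoice (Function.update U b u) j m = sndChoice U j m := by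
  unfold sndChoice
  split_ifs with hjm
  · rw [Function.update_of_ne]
    rintro rfl
    exact h rfl
  · rfl

theorem fstChoice_update_self {n : ℕ} (U : Choice n) (b : Fin n × Fin n)
    (u : Fin (4 ^ (b.1 : ℕ) / 2 + 1) × Fin (4 ^ (b.1 : ℕ) / 2 + 1)) :
    fstChoice (Function.update U b u) b.1 b.2 = u.1 := by
  simp [fstChoice]

theorem sndChoice_update_self {n : ℕ} (U : Choice n) (b : Fin n × Fin n)
    (u : Fin (4 ^ (b.1 : ℕ) / 2 + 1) × Fin (4 ^ (b.1 : ℕ) / 2 + 1)) :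
    sndChoice (Function.update U b u) b.1 b.2 = u.2 := by
  simp [sndChoice]

/-- Natural numbers at distance at most one. -/
def Near (a b : ℕ) : Prop := a ≤ b + 1 ∧ b ≤ a + 1

instance (a b : ℕ) : Decidable (Near a b) := inferInstanceAs (Decidable (_ ∧ _))

theorem card_near_le (c p K : ℕ) :
    ((univ : Finset (Fin K)).filter fun u : Fin K => Near (c + u) p).card ≤ 3 := by
  have : ((univ : Finset (Fin K)).filter fun u : Fin K => Near (c + u) p).card ≤ (range 3).card := by
    refine card_le_card_of_injOn (fun u => c + u + 1 - p) (fun u hu => ?_) fun u hu v hv huv => ?_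
    · have h1 : Near (c + u) p := (mem_filter.1 hu).2
      rw [Near] at h1
      simp only [coe_range, Set.mem_Iio]
      omega
    · have h1 : Near (c + u) p := (mem_filter.1 hu).2
      have h2 : Near (c + v) p := (mem_filter.1 hv).2
      rw [Near] at h1 h2
      simp only at huv
      exact Fin.ext (by omega)
  simpa using this

/-- The indicator that the random walk is close to `(p t, q t)` at time `t`. -/
def hit {n : ℕ} (p q : ℕ → ℕ) (U : Choice n) (t : ℕ) : ℝ :=
  if Near (pos (fstChoice U) t) (p t) ∧ Near (pos (sndChoice U) t) (q t) then 1 else 0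

theorem hit_nonneg {n : ℕ} (p q : ℕ → ℕ) (U : Choice n) (t : ℕ) : 0 ≤ hit p q U t := by
  unfold hit; split_ifs <;> norm_num

theorem hit_le_one {n : ℕ} (p q : ℕ → ℕ) (U : Choice n) (t : ℕ) : hit p q U t ≤ 1 := by
  unfold hit; split_ifs <;> norm_num

theorem pos_update_of_le {n : ℕ} (U : Choice n) (b : Fin n × Fin n)
    (u : Fin (4 ^ (b.1 : ℕ) / 2 + 1) × Fin (4 ^ (b.1 : ℕ) / 2 + 1)) {t : ℕ}
    (ht : t ≤ b.2 * 8 ^ (b.1 : ℕ)) :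
    pos (fstChoice (Function.update U b u)) t = pos (fstChoice U) t ∧
      pos (sndChoice (Function.update U b u)) t = pos (sndChoice U) t :=
  ⟨pos_congr (fun _ _ h => fstChoice_update_of_ne U b u h) ht,
    pos_congr (fun _ _ h => sndChoice_update_of_ne U b u h) ht⟩

/-- After the block both displacements are pure translations, and each coordinate is within `1` of
its target for at most `3` values, hence `9 = 3 * 3`. -/
theorem sum_hit_update_le {n : ℕ} (p q : ℕ → ℕ) (U : Choice n) (b : Fin n × Fin n) {t : ℕ}
    (ht : (b.2 + 1) * 8 ^ (b.1 : ℕ) ≤ t) : ∑ u, hit p q (Function.update U b u) t ≤ 9 := by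
  set c := pos (fstChoice (Function.update U b (0, 0))) t
  set c' := pos (sndChoice (Function.update U b (0, 0))) t
  have h1 : ∀ u : Fin (4 ^ (b.1 : ℕ) / 2 + 1) × Fin (4 ^ (b.1 : ℕ) / 2 + 1),
      pos (fstChoice (Function.update U b u)) t = c + u.1 := fun u => by
    have := pos_eq_add (V := fstChoice (Function.update U b u))
      (V' := fstChoice (Function.update U b (0, 0))) (j := b.1) (m := b.2)
      (fun j m h => by rw [fstChoice_update_of_ne _ _ _ h, fstChoice_update_of_ne _ _ _ h])
      (by rw [fstChoice_update_self]; rfl)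
      (by rw [fstChoice_update_self]; exact Nat.le_of_lt_succ u.1.2) ht
    rwa [fstChoice_update_self] at this
  have h2 : ∀ u : Fin (4 ^ (b.1 : ℕ) / 2 + 1) × Fin (4 ^ (b.1 : ℕ) / 2 + 1),
      pos (sndChoice (Function.update U b u)) t = c' + u.2 := fun u => by
    have := pos_eq_add (V := sndChoice (Function.update U b u))
      (V' := sndChoice (Function.update U b (0, 0))) (j := b.1) (m := b.2)
      (fun j m h => by rw [sndChoice_update_of_ne _ _ _ h, sndChoice_update_of_ne _ _ _ h])
      (by rw [sndChoice_update_self]; rfl)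
      (by rw [sndChoice_update_self]; exact Nat.le_of_lt_succ u.2.2) ht
    rwa [sndChoice_update_self] at this
  simp only [hit, h1, h2]
  rw [sum_boole]
  have h3 : ((univ : Finset (Fin (4 ^ (b.1 : ℕ) / 2 + 1) × Fin (4 ^ (b.1 : ℕ) / 2 + 1))).filter
      fun u => Near (c + u.1) (p t) ∧ Near (c' + u.2) (q t)).card ≤ 9 := by
    rw [← univ_product_univ, filter_product (fun u : Fin _ => Near (c + u) (p t))
      (fun u : Fin _ => Near (c' + u) (q t)), card_product]
    exact (Nat.mul_le_mul (card_near_le _ _ _) (card_near_le _ _ _)).trans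
      (show 3 * 3 ≤ 9 by norm_num)
  exact_mod_cast h3

/-- The scale available in a time interval of length `k`. -/
def scale (k : ℕ) : ℕ := Nat.log 8 (k / 2)

/-- The decorrelation profile of the walk. -/
noncomputable def profile (k : ℕ) : ℝ := 36 * (16 ^ scale k)⁻¹

theorem profile_nonneg (k : ℕ) : 0 ≤ profile k := by unfold profile; positivity

/-- At most `16 * 8 ^ j` lags have scale `j`, each with profile `36 / 16 ^ j`: a geometric series
`576 * 2 ^ (-j)`. A single transverse coordinate would give `8 ^ j / 4 ^ j`, which diverges. -/
theorem sum_profile_le (N : ℕ) : ∑ k ∈ range N, profile k ≤ 1152 := by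
  have hmaps : ∀ k ∈ range N, scale k ∈ range (N + 1) := fun k hk => by
    have h1 : scale k ≤ k / 2 := Nat.log_le_self 8 (k / 2)
    rw [mem_range] at hk ⊢
    omega
  rw [← sum_fiberwise_of_maps_to hmaps]
  have hfib : ∀ j ∈ range (N + 1), ∑ k ∈ (range N).filter (fun k => scale k = j), profile k ≤
      576 * (1 / 2 : ℝ) ^ j := fun j _ => by
    have h1 : ∑ k ∈ (range N).filter (fun k => scale k = j), profile k =
        ((range N).filter (fun k => scale k = j)).card * (36 * ((16 : ℝ) ^ j)⁻¹) := by
      rw [← nsmul_eq_mul, ← sum_const]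
      refine sum_congr rfl fun k hk => ?_
      rw [profile, (mem_filter.1 hk).2]
    have h2 : ((range N).filter (fun k => scale k = j)).card ≤ 16 * 8 ^ j := by
      rw [← card_range (16 * 8 ^ j)]
      refine card_le_card fun k hk => ?_
      rw [mem_filter, scale] at hk
      have h3 := Nat.lt_pow_succ_log_self (b := 8) (by norm_num) (k / 2)
      rw [hk.2, pow_succ] at h3
      rw [mem_range]
      omega
    have h3 : (((range N).filter (fun k => scale k = j)).card : ℝ) ≤ 16 * 8 ^ j := by
      exact_mod_cast h2
    rw [h1]
    have h4 : (16 * 8 ^ j : ℝ) * (36 * (16 ^ j)⁻¹) = 576 * (1 / 2) ^ j := by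
      rw [show (16 : ℝ) = 8 * 2 by norm_num, mul_pow, one_div, inv_pow]
      field_simp
      norm_num
    rw [← h4]
    gcongr
  refine (sum_le_sum hfib).trans ?_
  rw [← mul_sum]
  have := sum_geometric_two_le (N + 1)
  linarith

/-- Decorrelation: given the walk up to time `s`, it is close to a given point at time `t` with
probability at most `profile (t - s)`. -/
theorem sum_hit_mul_le {n s t : ℕ} (hst : s < t) (htn : t ≤ n) (p q : ℕ → ℕ) (Φ : Choice n → ℝ)
    (hΦ0 : ∀ U, 0 ≤ Φ U)
    (hΦ : ∀ U U' : Choice n, (∀ t' ≤ s, pos (fstChoice U) t' = pos (fstChoice U') t' ∧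
      pos (sndChoice U) t' = pos (sndChoice U') t') → Φ U = Φ U') :
    ∑ U, hit p q U t * Φ U ≤ profile (t - s) * ∑ U, Φ U := by
  by_cases hk : t - s < 2
  · have hp : profile (t - s) = 36 := by
      simp [profile, scale, Nat.div_eq_of_lt hk]
    rw [hp, mul_sum]
    refine sum_le_sum fun U _ => mul_le_mul_of_nonneg_right ?_ (hΦ0 U)
    linarith [hit_le_one p q U t]
  set j := scale (t - s) with hj
  have h8 : 0 < 8 ^ j := by positivity
  have h8le : 8 ^ j ≤ (t - s) / 2 := Nat.pow_log_le_self 8 (by omega)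
  have hj8 : j < 8 ^ j := Nat.lt_pow_self (by norm_num)
  -- The ceiling of `s / 8 ^ j`. Since `2 * 8 ^ j ≤ t - s`, this first aligned block starting at or
  -- after `s` ends by `t`, so its displacement can be resampled without changing `Φ`.
  set m := (s + 8 ^ j - 1) / 8 ^ j with hm
  have hm1 : s ≤ m * 8 ^ j := by
    have := Nat.lt_div_mul_add (a := s + 8 ^ j - 1) h8
    rw [← hm] at this
    omega
  have hm2 : (m + 1) * 8 ^ j ≤ t := by
    have := Nat.div_mul_le_self (s + 8 ^ j - 1) (8 ^ j)
    rw [← hm] at this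
    rw [add_mul]
    omega
  have hmn : m < n := by
    have : m + 1 ≤ (m + 1) * 8 ^ j := Nat.le_mul_of_pos_right _ h8
    omega
  let b : Fin n × Fin n := (⟨j, by omega⟩, ⟨m, hmn⟩)
  have hΦu : ∀ U u, Φ (Function.update U b u) = Φ U := fun U u =>
    hΦ _ _ fun t' ht' => pos_update_of_le U b u (ht'.trans hm1)
  have hK := sum_sum_update b (fun U => hit p q U t * Φ U)
  simp only [hΦu, ← sum_mul] at hK
  have h9 : ∑ U, (∑ u, hit p q (Function.update U b u) t) * Φ U ≤ ∑ U, 9 * Φ U :=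
    sum_le_sum fun U _ => mul_le_mul_of_nonneg_right (sum_hit_update_le p q U b hm2) (hΦ0 U)
  rw [hK, ← mul_sum] at h9
  -- At least `16 ^ j / 4` displacement pairs, of which at most `9` hit: this is the constant `36`
  -- of the profile.
  have hcard : (16 : ℝ) ^ j ≤
      4 * (Fintype.card (Fin (4 ^ (b.1 : ℕ) / 2 + 1) × Fin (4 ^ (b.1 : ℕ) / 2 + 1)) : ℝ) := by
    have h1 : 4 ^ j ≤ 2 * (4 ^ j / 2 + 1) := by omega
    have h2 : 16 ^ j ≤ 4 * ((4 ^ j / 2 + 1) * (4 ^ j / 2 + 1)) := by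
      calc 16 ^ j = 4 ^ j * 4 ^ j := by rw [← Nat.mul_pow]
        _ ≤ (2 * (4 ^ j / 2 + 1)) * (2 * (4 ^ j / 2 + 1)) := Nat.mul_le_mul h1 h1
        _ = _ := by ring
    rw [Fintype.card_prod, Fintype.card_fin]
    exact_mod_cast h2
  have hS : 0 ≤ ∑ U, hit p q U t * Φ U :=
    sum_nonneg fun U _ => mul_nonneg (hit_nonneg _ _ _ _) (hΦ0 U)
  have h16 : (0 : ℝ) < 16 ^ j := by positivity
  rw [profile, ← hj, mul_assoc, inv_mul_eq_div, ← mul_div_assoc, le_div_iff₀ h16]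
  nlinarith [mul_le_mul_of_nonneg_left hcard hS]

/-- The number of near-collisions of the random walk with a given trajectory has uniformly bounded
exponential moments. -/
theorem sum_prod_hit_le (n : ℕ) (p q : ℕ → ℕ) {r : ℝ} (hr : 0 ≤ r) (hr2 : r * 1152 ≤ 1 / 2) :
    ∑ U : Choice n, ∏ s ∈ range n, (1 + r * hit p q U s) ≤
      Fintype.card (Choice n) * (1 + 2304 * r) := by
  set C : ℝ := (Fintype.card (Choice n) : ℝ) with hC
  have hCpos : 0 < C := by rw [hC]; exact_mod_cast Fintype.card_pos
  have hfac : ∀ U : Choice n, ∀ s, 0 ≤ 1 + r * hit p q U s := fun U s =>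
    add_nonneg zero_le_one (mul_nonneg hr (hit_nonneg _ _ _ _))
  -- The mean weight of a hit at time `t`, tilted by the earlier hits; by decorrelation it satisfies
  -- the renewal inequality.
  set a : ℕ → ℝ := fun t => C⁻¹ *
    ∑ U : Choice n, hit p q U t * ∏ s ∈ range t, (1 + r * hit p q U s) with ha
  have ha0 : ∀ t, 0 ≤ a t := fun t => mul_nonneg (inv_pos.2 hCpos).le
    (sum_nonneg fun U _ => mul_nonneg (hit_nonneg _ _ _ _) (prod_nonneg fun s _ => hfac U s))
  have hrec : ∀ t < n, a t ≤ profile t + r * ∑ s ∈ range t, profile (t - s) * a s := by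
    intro t ht
    have h1 : ∑ U : Choice n, hit p q U t ≤ profile t * C := by
      rcases Nat.eq_zero_or_pos t with rfl | htpos
      · have hp : profile 0 = 36 := by simp [profile, scale]
        calc ∑ U : Choice n, hit p q U 0 ≤ ∑ _U : Choice n, (1 : ℝ) :=
              sum_le_sum fun U _ => hit_le_one _ _ _ _
          _ = C := by simp [hC]
          _ ≤ _ := by rw [hp]; linarith
      · have := sum_hit_mul_le (s := 0) htpos ht.le p q (fun _ => (1 : ℝ))
          (fun _ => zero_le_one) (fun _ _ _ => rfl)
        simpa [hC] using this
    have h2 : ∀ s ∈ range t, ∑ U : Choice n, hit p q U t *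
        (hit p q U s * ∏ s' ∈ range s, (1 + r * hit p q U s')) ≤ profile (t - s) * (C * a s) := by
      intro s hs
      have h3 : C * a s = ∑ U : Choice n, hit p q U s * ∏ s' ∈ range s, (1 + r * hit p q U s') := by
        rw [ha]; exact mul_inv_cancel_left₀ hCpos.ne' _
      rw [h3]
      refine sum_hit_mul_le (mem_range.1 hs) ht.le p q _ (fun U => mul_nonneg (hit_nonneg _ _ _ _)
        (prod_nonneg fun s _ => hfac U s)) fun U U' h => ?_
      have hh : ∀ s' ≤ s, hit p q U s' = hit p q U' s' := fun s' hs' => by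
        rw [hit, hit, (h s' hs').1, (h s' hs').2]
      rw [hh s le_rfl]
      congr 1
      exact prod_congr rfl fun s' hs' => by rw [hh s' (mem_range.1 hs').le]
    have h4 : C * a t = ∑ U : Choice n, hit p q U t + r * ∑ s ∈ range t, ∑ U : Choice n,
        hit p q U t * (hit p q U s * ∏ s' ∈ range s, (1 + r * hit p q U s')) := by
      rw [ha, sum_comm, mul_sum, ← sum_add_distrib]
      simp only
      rw [mul_inv_cancel_left₀ hCpos.ne']
      refine sum_congr rfl fun U _ => ?_
      rw [prod_one_add_eq_sum, mul_add, mul_one, ← mul_sum]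
      ring
    have h5 : C * a t ≤ C * (profile t + r * ∑ s ∈ range t, profile (t - s) * a s) := by
      rw [h4, mul_add, mul_comm C]
      refine add_le_add h1 ?_
      rw [mul_left_comm]
      refine mul_le_mul_of_nonneg_left ((sum_le_sum h2).trans (le_of_eq ?_)) hr
      rw [mul_sum]
      exact sum_congr rfl fun s _ => by ring
    exact le_of_mul_le_mul_left h5 hCpos
  have hsum := sum_le_of_renewal ha0 hr sum_profile_le profile_nonneg hrec
  have hA : 0 ≤ ∑ t ∈ range n, a t := sum_nonneg fun t _ => ha0 t
  have hA2 : ∑ t ∈ range n, a t ≤ 2304 := by nlinarith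
  have hfin : ∑ U : Choice n, ∏ s ∈ range n, (1 + r * hit p q U s) =
      C * (1 + r * ∑ t ∈ range n, a t) := by
    rw [sum_congr rfl fun U _ => prod_one_add_eq_sum r (hit p q U) n, sum_add_distrib, ← mul_sum, sum_comm, ha, ← mul_sum, mul_add, mul_left_comm C,
      mul_inv_cancel_left₀ hCpos.ne']
    simp [hC]
  rw [hfin]
  refine mul_le_mul_of_nonneg_left ?_ hCpos.le
  nlinarith

end MultiscaleWalk

end

/-! ### Flows carried by lattice walks, zigzag walks and their common edges. -/

section

open Finset MultiscaleWalk

namespace NishimoriXY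

variable {d : ℕ}

/-- The number of signed passages of the walk `v 0, …, v M` through the edge `e`. -/
def walkFlow (Λ : Finset (Site d)) (v : ℕ → Site d) (M : ℕ) (e : positiveEdges Λ) : ℤ :=
  ∑ k ∈ range M, ((if v k = e.1.1 ∧ v (k + 1) = e.1.2 then 1 else 0) -
    (if v (k + 1) = e.1.1 ∧ v k = e.1.2 then 1 else 0))

/-- Lazy nearest neighbour walks with `M` steps. -/
def IsLazyWalk (v : ℕ → Site d) (M : ℕ) : Prop :=
  ∀ k < M, v k = v (k + 1) ∨ NearestNeighbor (v k) (v (k + 1))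

/-- Walks that use every unoriented edge at most once. -/
def IsTrailUpTo (v : ℕ → Site d) (M : ℕ) : Prop :=
  ∀ k < M, ∀ k' < M, v k ≠ v (k + 1) → (v k = v k' ∧ v (k + 1) = v (k' + 1) ∨
    v k = v (k' + 1) ∧ v (k + 1) = v k') → k = k'

theorem positiveEdges_ne {Λ : Finset (Site d)} (e : positiveEdges Λ) :
    (e.1.1 : Site d) ≠ e.1.2 := by
  obtain ⟨⟨i, j⟩, he⟩ := e
  intro h
  have h' : i = j := Subtype.ext h
  subst h'
  exact not_swap_mem_positiveEdges he he

/-- Each proper step meets exactly one positive edge, with sign according to its direction, so its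
contribution is an increment of `F` and the sum telescopes. -/
theorem sum_walkFlow_mul {Λ : Finset (Site d)} {v : ℕ → Site d} {M : ℕ}
    (hv : ∀ k ≤ M, v k ∈ Λ) (hw : IsLazyWalk v M) (F : Site d → ℝ) :
    ∑ e : positiveEdges Λ, (walkFlow Λ v M e : ℝ) * (F e.1.1 - F e.1.2) = F (v 0) - F (v M) := by
  have hstep : ∀ k ∈ range M, ∑ e : positiveEdges Λ,
      (((if v k = e.1.1 ∧ v (k + 1) = e.1.2 then 1 else 0 : ℝ) -
        (if v (k + 1) = e.1.1 ∧ v k = e.1.2 then 1 else 0)) * (F e.1.1 - F e.1.2)) =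
      F (v k) - F (v (k + 1)) := by
    intro k hk
    rw [mem_range] at hk
    rcases hw k hk with h | h
    · rw [h, sub_self]
      refine sum_eq_zero fun e _ => ?_
      have : ¬(v (k + 1) = e.1.1 ∧ v (k + 1) = e.1.2) := fun hh =>
        positiveEdges_ne e (hh.1.symm.trans hh.2)
      simp [this]
    · let i : Λ := ⟨v k, hv k hk.le⟩
      let j : Λ := ⟨v (k + 1), hv (k + 1) hk⟩
      have hmem : ∀ i j : Λ, NearestNeighbor (i : Site d) j → (i : Site d) ≤ j →
          (i, j) ∈ positiveEdges Λ := fun i j h hle => by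
        simp only [positiveEdges, orientedEdges, mem_filter, mem_univ, true_and]
        exact ⟨h, hle⟩
      have hA : ∀ e : positiveEdges Λ, (v k = e.1.1 ∧ v (k + 1) = e.1.2) ↔ e.1 = (i, j) := by
        rintro ⟨⟨i', j'⟩, he⟩
        simp only [Prod.mk.injEq, Subtype.ext_iff, i, j, eq_comm]
      have hB : ∀ e : positiveEdges Λ, (v (k + 1) = e.1.1 ∧ v k = e.1.2) ↔ e.1 = (j, i) := by
        rintro ⟨⟨i', j'⟩, he⟩
        simp only [Prod.mk.injEq, Subtype.ext_iff, i, j, eq_comm]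
      simp only [hA, hB]
      rcases h.le_or_le with hle | hle
      · have he := hmem i j h hle
        have he' := not_swap_mem_positiveEdges he
        have hB' : ∀ e : positiveEdges Λ, e.1 ≠ (j, i) := fun e hh => he' (hh ▸ e.2)
        rw [Fintype.sum_eq_single ⟨(i, j), he⟩]
        · simp [hB' ⟨(i, j), he⟩, i, j]
        · intro e hne
          have : e.1 ≠ (i, j) := fun hh => hne (Subtype.ext hh)
          simp [this, hB' e]
      · have he := hmem j i h.symm hle
        have he' := not_swap_mem_positiveEdges he
        have hA' : ∀ e : positiveEdges Λ, e.1 ≠ (i, j) := fun e hh => he' (hh ▸ e.2)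
        rw [Fintype.sum_eq_single ⟨(j, i), he⟩]
        · simp [hA' ⟨(j, i), he⟩, i, j]
        · intro e hne
          have : e.1 ≠ (j, i) := fun hh => hne (Subtype.ext hh)
          simp [this, hA' e]
  simp only [walkFlow]
  push_cast
  simp only [sum_mul]
  rw [sum_comm, sum_congr rfl hstep, sum_range_sub']

theorem exists_of_walkFlow_ne_zero {Λ : Finset (Site d)} {v : ℕ → Site d} {M : ℕ}
    {e : positiveEdges Λ} (h : walkFlow Λ v M e ≠ 0) :
    ∃ k < M, (v k = e.1.1 ∧ v (k + 1) = e.1.2) ∨ (v (k + 1) = e.1.1 ∧ v k = e.1.2) := by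
  obtain ⟨k, hk, hne⟩ := exists_ne_zero_of_sum_ne_zero h
  refine ⟨k, mem_range.1 hk, ?_⟩
  by_contra hcon
  rw [not_or] at hcon
  simp [hcon.1, hcon.2] at hne

theorem abs_walkFlow_le_one {Λ : Finset (Site d)} {v : ℕ → Site d} {M : ℕ}
    (hv : IsTrailUpTo v M) (e : positiveEdges Λ) : |walkFlow Λ v M e| ≤ 1 := by
  by_cases h : walkFlow Λ v M e = 0
  · simp [h]
  obtain ⟨k, hk, hke⟩ := exists_of_walkFlow_ne_zero h
  have hne := positiveEdges_ne e
  rw [walkFlow, sum_eq_single_of_mem k (mem_range.2 hk)]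
  · split_ifs <;> simp
  · intro k' hk' hkk'
    rw [mem_range] at hk'
    have h1 : ¬(v k' = e.1.1 ∧ v (k' + 1) = e.1.2) := fun h1 => hkk' <| by
      refine (hv k hk k' hk' ?_ ?_).symm
      · rcases hke with h2 | h2
        · rw [h2.1, h2.2]; exact hne
        · rw [h2.1, h2.2]; exact hne.symm
      · rcases hke with h2 | h2
        · exact Or.inl ⟨h2.1.trans h1.1.symm, h2.2.trans h1.2.symm⟩
        · exact Or.inr ⟨h2.2.trans h1.2.symm, h2.1.trans h1.1.symm⟩
    have h3 : ¬(v (k' + 1) = e.1.1 ∧ v k' = e.1.2) := fun h1 => hkk' <| by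
      refine (hv k hk k' hk' ?_ ?_).symm
      · rcases hke with h2 | h2
        · rw [h2.1, h2.2]; exact hne
        · rw [h2.1, h2.2]; exact hne.symm
      · rcases hke with h2 | h2
        · exact Or.inr ⟨h2.1.trans h1.1.symm, h2.2.trans h1.2.symm⟩
        · exact Or.inl ⟨h2.2.trans h1.2.symm, h2.1.trans h1.1.symm⟩
    rw [if_neg h1, if_neg h3, sub_zero]

theorem nearestNeighbor_of_coord {u v : Site d} (i : Fin d) (hi : |u i - v i| = 1)
    (h : ∀ j ≠ i, u j = v j) : NearestNeighbor u v := by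
  rw [NearestNeighbor, sum_eq_single i (fun j _ hj => by simp [h j hj]) (by simp), hi]

/-- The walk from `x` that moves in direction `a` at every third step, and whose transverse
coordinates follow `S` and `T`. -/
def zigzag (x : Site d) (a b c : Fin d) (S T : ℕ → ℕ) (k : ℕ) : Site d := fun i =>
  x i + if i = a then ((k / 3 : ℕ) : ℤ) else if i = b then (S ((k + 2) / 3) : ℤ)
    else if i = c then (T ((k + 1) / 3) : ℤ) else 0

/-- Sequences with increments in `{0, 1}`. -/
def IsStaircase (S : ℕ → ℕ) : Prop := ∀ t, S (t + 1) = S t ∨ S (t + 1) = S t + 1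

section Zigzag

variable {x : Site d} {a b c : Fin d} {S T S' T' : ℕ → ℕ}

theorem zigzag_apply_a (k : ℕ) : zigzag x a b c S T k a = x a + (k / 3 : ℕ) := by simp [zigzag]

theorem zigzag_apply_b (hab : a ≠ b) (k : ℕ) :
    zigzag x a b c S T k b = x b + S ((k + 2) / 3) := by simp [zigzag, hab.symm]

theorem zigzag_apply_c (hac : a ≠ c) (hbc : b ≠ c) (k : ℕ) :
    zigzag x a b c S T k c = x c + T ((k + 1) / 3) := by simp [zigzag, hac.symm, hbc.symm]

theorem zigzag_apply_of_ne {i : Fin d} (ha : i ≠ a) (hb : i ≠ b) (hc : i ≠ c) (k : ℕ) :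
    zigzag x a b c S T k i = x i := by simp [zigzag, ha, hb, hc]

theorem zigzag_succ (hab : a ≠ b) (hac : a ≠ c) (hbc : b ≠ c) (hS : IsStaircase S)
    (hT : IsStaircase T) (k : ℕ) : zigzag x a b c S T k ≤ zigzag x a b c S T (k + 1) ∧
      (zigzag x a b c S T k = zigzag x a b c S T (k + 1) ∨
        NearestNeighbor (zigzag x a b c S T k) (zigzag x a b c S T (k + 1))) := by
  -- Exactly one of the three clocks ticks: that of `b`, `c`, `a` for `k` congruent to `0`, `1`, `2`
  -- modulo `3`.
  have hcases : (k / 3 + 1 = (k + 1) / 3 ∧ (k + 2) / 3 = (k + 1 + 2) / 3 ∧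
      (k + 1) / 3 = (k + 1 + 1) / 3) ∨
      (k / 3 = (k + 1) / 3 ∧ (k + 2) / 3 + 1 = (k + 1 + 2) / 3 ∧ (k + 1) / 3 = (k + 1 + 1) / 3) ∨
      (k / 3 = (k + 1) / 3 ∧ (k + 2) / 3 = (k + 1 + 2) / 3 ∧ (k + 1) / 3 + 1 = (k + 1 + 1) / 3) := by
    omega
  have hext : ∀ i : Fin d, i = a ∨ i = b ∨ i = c ∨ (i ≠ a ∧ i ≠ b ∧ i ≠ c) := fun i => by tauto
  have key : ∀ i0 : Fin d, (zigzag x a b c S T (k + 1) i0 = zigzag x a b c S T k i0 ∨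
      zigzag x a b c S T (k + 1) i0 = zigzag x a b c S T k i0 + 1) →
      (∀ i ≠ i0, zigzag x a b c S T k i = zigzag x a b c S T (k + 1) i) →
      zigzag x a b c S T k ≤ zigzag x a b c S T (k + 1) ∧
      (zigzag x a b c S T k = zigzag x a b c S T (k + 1) ∨
        NearestNeighbor (zigzag x a b c S T k) (zigzag x a b c S T (k + 1))) := by
    intro i0 h0 h1
    constructor
    · intro i
      by_cases hi : i = i0
      · subst hi
        rcases h0 with h | h
        · exact h.ge
        · rw [h]; exact (lt_add_one _).le
      · exact (h1 i hi).le
    · rcases h0 with h | h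
      · left
        funext i
        by_cases hi : i = i0
        · subst hi; exact h.symm
        · exact h1 i hi
      · right
        exact nearestNeighbor_of_coord i0 (by rw [h]; simp) h1
  rcases hcases with ⟨h1, h2, h3⟩ | ⟨h1, h2, h3⟩ | ⟨h1, h2, h3⟩
  · refine key a (Or.inr ?_) fun i hi => ?_
    · rw [zigzag_apply_a, zigzag_apply_a, ← h1]; push_cast; ring
    · simp only [zigzag, hi, if_false, h2, h3]
  · refine key b ?_ fun i hi => ?_
    · rw [zigzag_apply_b hab, zigzag_apply_b hab, ← h2]
      have := hS ((k + 2) / 3)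
      omega
    · simp only [zigzag, hi, if_false, h1, h3]
  · refine key c ?_ fun i hi => ?_
    · rw [zigzag_apply_c hac hbc, zigzag_apply_c hac hbc, ← h3]
      have := hT ((k + 1) / 3)
      omega
    · simp only [zigzag, hi, if_false, h1, h2]

theorem isLazyWalk_zigzag (hab : a ≠ b) (hac : a ≠ c) (hbc : b ≠ c) (hS : IsStaircase S)
    (hT : IsStaircase T) (M : ℕ) : IsLazyWalk (zigzag x a b c S T) M :=
  fun k _ => (zigzag_succ hab hac hbc hS hT k).2

/-- The walk is monotone for the coordinatewise order, so it cannot return to an edge once crossed.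
-/
theorem isTrailUpTo_zigzag (hab : a ≠ b) (hac : a ≠ c) (hbc : b ≠ c) (hS : IsStaircase S)
    (hT : IsStaircase T) (M : ℕ) : IsTrailUpTo (zigzag x a b c S T) M := by
  have hmono : Monotone (zigzag x a b c S T) :=
    monotone_nat_of_le_succ fun k => (zigzag_succ hab hac hbc hS hT k).1
  intro k _ k' _ hne h
  rcases h with ⟨h1, h2⟩ | ⟨h1, h2⟩
  · by_contra hkk
    rcases lt_or_gt_of_ne hkk with hlt | hlt
    · exact hne (le_antisymm (hmono k.le_succ) ((hmono hlt).trans h1.ge))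
    · exact hne (le_antisymm (hmono k.le_succ) (h2.le.trans ((hmono hlt))))
  · exact absurd (le_antisymm (hmono k.le_succ)
      (h2.le.trans ((hmono k'.le_succ).trans h1.ge))) hne

/-- The coordinate `a` is a clock, so walks that meet do so at the same time `k / 3`. The offsets
within a period of three shift the staircases by at most one step, hence `Near` instead of equality.
-/
theorem near_of_zigzag_eq (hab : a ≠ b) (hac : a ≠ c) (hbc : b ≠ c) (hS : IsStaircase S)
    (hT : IsStaircase T) (hS' : IsStaircase S') (hT' : IsStaircase T') {k k' : ℕ}
    (h : zigzag x a b c S T k = zigzag x a b c S' T' k') :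
    Near (S (k / 3)) (S' (k / 3)) ∧ Near (T (k / 3)) (T' (k / 3)) := by
  have h1 := congrFun h a
  have h2 := congrFun h b
  have h3 := congrFun h c
  rw [zigzag_apply_a, zigzag_apply_a] at h1
  rw [zigzag_apply_b hab, zigzag_apply_b hab] at h2
  rw [zigzag_apply_c hac hbc, zigzag_apply_c hac hbc] at h3
  have e1 : k' / 3 = k / 3 := by omega
  have e2 : S ((k + 2) / 3) = S' ((k' + 2) / 3) := by omega
  have e3 : T ((k + 1) / 3) = T' ((k' + 1) / 3) := by omega
  have hS1 := hS (k / 3)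
  have hT1 := hT (k / 3)
  have hS2 := hS' (k / 3)
  have hT2 := hT' (k / 3)
  have f1 : (k + 2) / 3 = k / 3 ∨ (k + 2) / 3 = k / 3 + 1 := by omega
  have f2 : (k' + 2) / 3 = k / 3 ∨ (k' + 2) / 3 = k / 3 + 1 := by omega
  have f3 : (k + 1) / 3 = k / 3 ∨ (k + 1) / 3 = k / 3 + 1 := by omega
  have f4 : (k' + 1) / 3 = k / 3 ∨ (k' + 1) / 3 = k / 3 + 1 := by omega
  constructor
  · rw [Near]
    rcases f1 with f1 | f1 <;> rcases f2 with f2 | f2 <;> rw [f1, f2] at e2 <;> omega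
  · rw [Near]
    rcases f3 with f1 | f1 <;> rcases f4 with f2 | f2 <;> rw [f1, f2] at e3 <;> omega

end Zigzag

/-- Reflection in the hyperplane where the coordinate `a` equals `s`. -/
def mirror (a : Fin d) (s : ℤ) (z : Site d) : Site d := Function.update z a (2 * s - z a)

theorem mirror_mirror (a : Fin d) (s : ℤ) (z : Site d) : mirror a s (mirror a s z) = z := by
  simp [mirror]

theorem mirror_injective (a : Fin d) (s : ℤ) : Function.Injective (mirror a s : Site d → Site d) :=
  Function.LeftInverse.injective (g := mirror a s) (mirror_mirror a s)

theorem NearestNeighbor.mirror {u v : Site d} (a : Fin d) (s : ℤ) (h : NearestNeighbor u v) :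
    NearestNeighbor (mirror a s u) (mirror a s v) := by
  rw [NearestNeighbor, ← h]
  refine sum_congr rfl fun i _ => ?_
  by_cases hi : i = a
  · subst hi
    simp only [NishimoriXY.mirror, Function.update_self]
    rw [show 2 * s - u i - (2 * s - v i) = -(u i - v i) by ring, abs_neg]
  · simp [NishimoriXY.mirror, hi]

theorem IsTrailUpTo.comp {v : ℕ → Site d} {M : ℕ} (hv : IsTrailUpTo v M) {σ : Site d → Site d}
    (hσ : Function.Injective σ) : IsTrailUpTo (fun k => σ (v k)) M := by
  intro k hk k' hk' hne h
  simp only [hσ.eq_iff, hσ.ne_iff] at h hne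
  exact hv k hk k' hk' hne h

/-- Each common edge is charged to a step of `v` crossing it. The charge is injective because a step
determines its unoriented edge, hence the positive one. -/
theorem card_common_edges_le {Λ : Finset (Site d)} {v w : ℕ → Site d} {M : ℕ} (P : ℕ → Prop)
    [DecidablePred P] (hP : ∀ k < M, ∀ k', v k = w k' → P k) {σ : Site d → Site d}
    (hσ : Function.Injective σ) :
    (univ.filter fun e : positiveEdges Λ => walkFlow Λ (fun k => σ (v k)) M e ≠ 0 ∧
      walkFlow Λ (fun k => σ (w k)) M e ≠ 0).card ≤ ((range M).filter P).card := by
  classical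
  have hex : ∀ e : positiveEdges Λ, ∃ k, (walkFlow Λ (fun k => σ (v k)) M e ≠ 0 ∧
      walkFlow Λ (fun k => σ (w k)) M e ≠ 0) → k < M ∧ P k ∧
      ((σ (v k) = e.1.1 ∧ σ (v (k + 1)) = e.1.2) ∨ (σ (v (k + 1)) = e.1.1 ∧ σ (v k) = e.1.2)) := by
    intro e
    by_cases he : walkFlow Λ (fun k => σ (v k)) M e ≠ 0 ∧ walkFlow Λ (fun k => σ (w k)) M e ≠ 0
    · obtain ⟨k, hk, hke⟩ := exists_of_walkFlow_ne_zero he.1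
      obtain ⟨k', -, hke'⟩ := exists_of_walkFlow_ne_zero he.2
      refine ⟨k, fun _ => ⟨hk, ?_, hke⟩⟩
      have : v k = w k' ∨ v k = w (k' + 1) := by
        rcases hke with h | h <;> rcases hke' with h' | h'
        · exact Or.inl (hσ (h.1.trans h'.1.symm))
        · exact Or.inr (hσ (h.1.trans h'.1.symm))
        · exact Or.inr (hσ (h.2.trans h'.2.symm))
        · exact Or.inl (hσ (h.2.trans h'.2.symm))
      rcases this with h | h
      · exact hP k hk _ h
      · exact hP k hk _ h
    · exact ⟨0, fun h => absurd h he⟩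
  choose κ hκ using hex
  refine card_le_card_of_injOn κ (fun e he => ?_) fun e he e' he' h => ?_
  · have := hκ e (mem_filter.1 he).2
    exact mem_filter.2 ⟨mem_range.2 this.1, this.2.1⟩
  · have h1 := (hκ e (mem_filter.1 he).2).2.2
    have h2 := (hκ e' (mem_filter.1 he').2).2.2
    rw [← h] at h2
    obtain ⟨⟨i, j⟩, hij⟩ := e
    obtain ⟨⟨i', j'⟩, hij'⟩ := e'
    have hswap : ¬((i : Site d) = j' ∧ (j : Site d) = i') := by
      rintro ⟨h3, h4⟩
      have h3' : i = j' := Subtype.ext h3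
      have h4' : j = i' := Subtype.ext h4
      subst h3' h4'
      exact not_swap_mem_positiveEdges hij hij'
    have hsame : (i : Site d) = i' ∧ (j : Site d) = j' := by
      rcases h1 with h1 | h1 <;> rcases h2 with h2 | h2
      · exact ⟨h1.1.symm.trans h2.1, h1.2.symm.trans h2.2⟩
      · exact absurd ⟨h1.1.symm.trans h2.2, h1.2.symm.trans h2.1⟩ hswap
      · exact absurd ⟨h1.1.symm.trans h2.2, h1.2.symm.trans h2.1⟩ hswap
      · exact ⟨h1.1.symm.trans h2.1, h1.2.symm.trans h2.2⟩
    simp only [Subtype.mk.injEq, Prod.mk.injEq]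
    exact ⟨Subtype.ext hsame.1, Subtype.ext hsame.2⟩

theorem card_filter_div_three_le (n : ℕ) (P : ℕ → Prop) [DecidablePred P] :
    ((range (3 * n)).filter fun k => P (k / 3)).card ≤ 3 * ((range n).filter P).card := by
  refine card_le_mul_card_image_of_maps_to (f := fun k => k / 3) (fun k hk => ?_) 3 fun s _ => ?_
  · simp only [mem_filter, mem_range] at hk ⊢
    exact ⟨by omega, hk.2⟩
  · have : ({k ∈ (range (3 * n)).filter fun k => P (k / 3) | k / 3 = s} : Finset ℕ) ⊆
        Ico (3 * s) (3 * s + 3) := fun k hk => by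
      simp only [mem_filter, mem_Ico] at hk ⊢
      omega
    exact (card_le_card this).trans (by simp)

end NishimoriXY

end

/-! ### Pairs at even distance along an axis, and nearest neighbours. -/

section

open Finset MultiscaleWalk

namespace NishimoriXY

variable {d : ℕ} {Λ : Finset (Site d)}

theorem isStaircase_pos (V : ℕ → ℕ → ℕ) : IsStaircase (pos V) := pos_succ V

theorem extend_apply (f : Λ → ℝ) (z : Λ) :
    (fun w : Site d => if h : w ∈ Λ then f ⟨w, h⟩ else 0) z = f z := by simp

/-- The random flow follows a zigzag from `x` to the midplane, then its mirror image backwards to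
`y`; they meet because the reflection fixes the midplane. The exponent `12` is `2` per common edge
times `6` common edges per near-collision. -/
theorem averagedGibbs_of_even_distance (β : ℝ) (h : Λ → ℝ) (x y : Λ) {a b c : Fin d}
    (hab : a ≠ b) (hac : a ≠ c) (hbc : b ≠ c) (n : ℕ)
    (hy : (y : Site d) = Function.update (x : Site d) a ((x : Site d) a + 2 * n))
    (hΛ : ∀ z : Site d, ((x : Site d) a ≤ z a ∧ z a ≤ (x : Site d) a + 2 * n) →
      (∀ i, i = b ∨ i = c → (x : Site d) i ≤ z i ∧ z i ≤ (x : Site d) i + n) →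
      (∀ i, i ≠ a → i ≠ b → i ≠ c → z i = (x : Site d) i) → z ∈ Λ)
    (hc0 : 0 < phaseFourier β 1) {r : ℝ} (hr : (phaseFourier β 1)⁻¹ ^ 12 = 1 + r)
    (hr2 : r * 1152 ≤ 1 / 2) :
    1 - 2304 * r ≤ averagedGibbs Λ β h (fun θ => Real.cos (θ x - θ y)) := by
  have hci : 1 ≤ (phaseFourier β 1)⁻¹ :=
    (one_le_inv₀ hc0).2 ((le_abs_self _).trans (abs_phaseFourier_le_one β 1))
  have hr0 : 0 ≤ r := by
    have := one_le_pow₀ hci (n := 12)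
    linarith
  set s : ℤ := (x : Site d) a + n with hs
  let u : Choice n → ℕ → Site d := fun U =>
    zigzag x a b c (pos (fstChoice U)) (pos (sndChoice U))
  let N : Choice n → positiveEdges Λ → ℤ := fun U e =>
    walkFlow Λ (u U) (3 * n) e - walkFlow Λ (fun k => mirror a s (u U k)) (3 * n) e
  have hua : ∀ U k, u U k a = (x : Site d) a + (k / 3 : ℕ) := fun U k => zigzag_apply_a k
  have humem : ∀ U, ∀ k ≤ 3 * n, u U k ∈ Λ := fun U k hk => by
    refine hΛ _ ?_ (fun i hi => ?_) fun i h1 h2 h3 => zigzag_apply_of_ne h1 h2 h3 k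
    · rw [hua]; omega
    · rcases hi with rfl | rfl
      · have h1 : u U k i = _ := zigzag_apply_b hab k
        have := pos_le_self (fstChoice U) ((k + 2) / 3)
        omega
      · have h1 : u U k i = _ := zigzag_apply_c hac hbc k
        have := pos_le_self (sndChoice U) ((k + 1) / 3)
        omega
  have hmmem : ∀ U, ∀ k ≤ 3 * n, mirror a s (u U k) ∈ Λ := fun U k hk => by
    refine hΛ _ ?_ (fun i hi => ?_) fun i h1 h2 h3 => ?_
    · simp only [mirror, Function.update_self]
      rw [hua]; omega
    · have hia : i ≠ a := by rcases hi with rfl | rfl <;> [exact hab.symm; exact hac.symm]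
      simp only [mirror, Function.update_of_ne hia]
      rcases hi with rfl | rfl
      · have h1 : u U k i = _ := zigzag_apply_b hab k
        have := pos_le_self (fstChoice U) ((k + 2) / 3)
        omega
      · have h1 : u U k i = _ := zigzag_apply_c hac hbc k
        have := pos_le_self (sndChoice U) ((k + 1) / 3)
        omega
    · simp only [mirror, Function.update_of_ne h1]
      exact zigzag_apply_of_ne h1 h2 h3 k
  have hwalk : ∀ U, IsLazyWalk (u U) (3 * n) := fun U =>
    isLazyWalk_zigzag hab hac hbc (isStaircase_pos _) (isStaircase_pos _) _
  have hmwalk : ∀ U, IsLazyWalk (fun k => mirror a s (u U k)) (3 * n) := fun U k hk =>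
    (hwalk U k hk).imp (fun h => congrArg _ h) fun h => h.mirror a s
  have htrail : ∀ U, IsTrailUpTo (u U) (3 * n) := fun U =>
    isTrailUpTo_zigzag hab hac hbc (isStaircase_pos _) (isStaircase_pos _) _
  have hlow : ∀ U e, walkFlow Λ (u U) (3 * n) e ≠ 0 →
      (e.1.1 : Site d) a < s ∨ (e.1.2 : Site d) a < s := fun U e he => by
    obtain ⟨k, hk, hke⟩ := exists_of_walkFlow_ne_zero he
    have h1 : u U k a < s := by rw [hua]; omega
    rcases hke with hke | hke
    · left; rwa [← hke.1]
    · right; rwa [← hke.2]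
  have hhigh : ∀ U e, walkFlow Λ (fun k => mirror a s (u U k)) (3 * n) e ≠ 0 →
      s ≤ (e.1.1 : Site d) a ∧ s ≤ (e.1.2 : Site d) a := fun U e he => by
    obtain ⟨k, hk, hke⟩ := exists_of_walkFlow_ne_zero he
    have h1 : ∀ k ≤ 3 * n, s ≤ mirror a s (u U k) a := fun k hk => by
      simp only [mirror, Function.update_self]
      rw [hua]; omega
    rcases hke with hke | hke
    · rw [← hke.1, ← hke.2]; exact ⟨h1 _ hk.le, h1 _ hk⟩
    · rw [← hke.1, ← hke.2]; exact ⟨h1 _ hk, h1 _ hk.le⟩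
  -- Edges of the first half have an endpoint strictly below the midplane and mirrored edges have
  -- none, so the halves share no edge, even for different choices.
  have hexcl : ∀ U U' e, walkFlow Λ (u U) (3 * n) e ≠ 0 →
      walkFlow Λ (fun k => mirror a s (u U' k)) (3 * n) e = 0 := fun U U' e he => by
    by_contra hcon
    have h1 := hlow U e he
    have h2 := hhigh U' e hcon
    omega
  -- Three steps per unit of the clock, in each of the two halves.
  have hcount : ∀ U U' : Choice n, (univ.filter fun e => N U e ≠ 0 ∧ N U' e ≠ 0).card ≤
      6 * ((range n).filter fun t => Near (pos (fstChoice U') t) (pos (fstChoice U) t) ∧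
        Near (pos (sndChoice U') t) (pos (sndChoice U) t)).card := fun U U' => by
    classical
    have hP := fun k (_ : k < 3 * n) k' (hk : u U' k = u U k') =>
      near_of_zigzag_eq hab hac hbc (isStaircase_pos _) (isStaircase_pos _) (isStaircase_pos _)
        (isStaircase_pos _) hk
    have h1 := card_common_edges_le (Λ := Λ) (v := u U') (w := u U) (M := 3 * n)
      (fun k => Near (pos (fstChoice U') (k / 3)) (pos (fstChoice U) (k / 3)) ∧
        Near (pos (sndChoice U') (k / 3)) (pos (sndChoice U) (k / 3))) hP Function.injective_id
    have h2 := card_common_edges_le (Λ := Λ) (v := u U') (w := u U) (M := 3 * n)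
      (fun k => Near (pos (fstChoice U') (k / 3)) (pos (fstChoice U) (k / 3)) ∧
        Near (pos (sndChoice U') (k / 3)) (pos (sndChoice U) (k / 3))) hP (mirror_injective a s)
    have h3 := card_filter_div_three_le n (fun t => Near (pos (fstChoice U') t)
      (pos (fstChoice U) t) ∧ Near (pos (sndChoice U') t) (pos (sndChoice U) t))
    have h4 : (univ.filter fun e => N U e ≠ 0 ∧ N U' e ≠ 0) ⊆
        (univ.filter fun e : positiveEdges Λ => walkFlow Λ (fun k => id (u U' k)) (3 * n) e ≠ 0 ∧
          walkFlow Λ (fun k => id (u U k)) (3 * n) e ≠ 0) ∪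
        (univ.filter fun e : positiveEdges Λ =>
          walkFlow Λ (fun k => mirror a s (u U' k)) (3 * n) e ≠ 0 ∧
          walkFlow Λ (fun k => mirror a s (u U k)) (3 * n) e ≠ 0) := fun e he => by
      simp only [mem_filter, mem_univ, true_and, mem_union, id] at he ⊢
      by_cases hU : walkFlow Λ (u U) (3 * n) e = 0
      · by_cases hU' : walkFlow Λ (u U') (3 * n) e = 0
        · right
          simp only [N, hU, hU', zero_sub, ne_eq, neg_eq_zero] at he
          exact ⟨he.2, he.1⟩
        · exfalso
          exact he.1 (by simp [N, hU, hexcl U' U e hU'])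
      · by_cases hU' : walkFlow Λ (u U') (3 * n) e = 0
        · exfalso
          exact he.2 (by simp [N, hU', hexcl U U' e hU])
        · exact Or.inl ⟨hU', hU⟩
    have h5 := (card_le_card h4).trans (card_union_le _ _)
    omega
  have hpair : ∀ U U' : Choice n, ((phaseFourier β 1)⁻¹ ^ 2) ^
      (univ.filter fun e => N U e ≠ 0 ∧ N U' e ≠ 0).card ≤
      ∏ t ∈ range n, (1 + r * hit (pos (fstChoice U)) (pos (sndChoice U)) U' t) := fun U U' => by
    have h1 : ∏ t ∈ range n, (1 + r * hit (pos (fstChoice U)) (pos (sndChoice U)) U' t) =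
        (1 + r) ^ ((range n).filter fun t => Near (pos (fstChoice U') t) (pos (fstChoice U) t) ∧
        Near (pos (sndChoice U') t) (pos (sndChoice U) t)).card := by
      rw [← prod_const, prod_filter]
      refine prod_congr rfl fun t _ => ?_
      unfold hit
      split_ifs <;> simp
    rw [h1, ← hr, ← pow_mul, ← pow_mul]
    refine pow_le_pow_right₀ hci ?_
    have := hcount U U'
    omega
  have key := second_moment_le_averagedGibbs β h x y hc0 N (fun U e => ?_) fun U f => ?_
  · refine le_trans ?_ key
    have hC : (0 : ℝ) < Fintype.card (Choice n) := by exact_mod_cast Fintype.card_pos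
    have h2 : ∑ U : Choice n, ∑ U' : Choice n, ((phaseFourier β 1)⁻¹ ^ 2) ^
        (univ.filter fun e => N U e ≠ 0 ∧ N U' e ≠ 0).card ≤
        ∑ _U : Choice n, (Fintype.card (Choice n) : ℝ) * (1 + 2304 * r) :=
      sum_le_sum fun U _ => (sum_le_sum fun U' _ => hpair U U').trans
        (sum_prod_hit_le n _ _ hr0 hr2)
    rw [sum_const, card_univ, nsmul_eq_mul, ← mul_assoc, ← sq] at h2
    have h3 := (div_le_iff₀ (by positivity : (0 : ℝ) < (Fintype.card (Choice n) : ℝ) ^ 2)).2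
      (h2.trans_eq (mul_comm _ _))
    linarith
  · by_cases hU : walkFlow Λ (u U) (3 * n) e = 0
    · simp only [N, hU, zero_sub, abs_neg]
      exact abs_walkFlow_le_one ((htrail U).comp (mirror_injective a s)) e
    · simp only [N, hexcl U U e hU, sub_zero]
      exact abs_walkFlow_le_one (htrail U) e
  · set F : Site d → ℝ := fun w => if h : w ∈ Λ then f ⟨w, h⟩ else 0 with hF
    have hFf : ∀ z : Λ, f z = F z := fun z => (extend_apply f z).symm
    have h1 := sum_walkFlow_mul (humem U) (hwalk U) F
    have h2 := sum_walkFlow_mul (hmmem U) (hmwalk U) F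
    have h3 : u U 0 = x := by
      funext i
      simp [u, zigzag, pos]
    have h4 : mirror a s (u U (3 * n)) = u U (3 * n) := by
      rw [mirror, hua, Function.update_eq_self_iff, hua]
      omega
    have h5 : mirror a s (u U 0) = y := by
      rw [h3, hy, mirror, hs]
      congr 1
      ring
    rw [h3] at h1
    simp only [h4, h5] at h2
    simp only [hFf]
    calc ∑ e : positiveEdges Λ, (N U e : ℝ) * (F e.1.1 - F e.1.2)
        = (F x - F (u U (3 * n))) - (F y - F (u U (3 * n))) := by
          rw [← h1, ← h2, ← sum_sub_distrib]
          refine sum_congr rfl fun e _ => ?_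
          simp only [N]
          push_cast
          ring
      _ = F x - F y := by ring

/-- A single path of one edge is a sufficient flow; this supplies the missing step at odd distances.
-/
theorem averagedGibbs_of_nearestNeighbor (β : ℝ) (h : Λ → ℝ) (x y : Λ)
    (hxy : NearestNeighbor (x : Site d) y) (hc0 : 0 < phaseFourier β 1) :
    2 - (phaseFourier β 1)⁻¹ ^ 2 ≤ averagedGibbs Λ β h (fun θ => Real.cos (θ x - θ y)) := by
  classical
  have hci : 1 ≤ (phaseFourier β 1)⁻¹ :=
    (one_le_inv₀ hc0).2 ((le_abs_self _).trans (abs_phaseFourier_le_one β 1))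
  let v : ℕ → Site d := fun k => if k = 0 then x else y
  have htrail : IsTrailUpTo v 1 := fun k hk k' hk' _ _ => by omega
  have hwalk : IsLazyWalk v 1 := fun k hk => by
    right
    rw [Nat.lt_one_iff.1 hk]
    simpa [v] using hxy
  have hmem : ∀ k ≤ 1, v k ∈ Λ := fun k _ => by
    by_cases hk : k = 0 <;> simp [v, hk]
  have key := second_moment_le_averagedGibbs β h x y hc0 (fun _ : Unit => walkFlow Λ v 1)
    (fun _ e => abs_walkFlow_le_one htrail e) fun _ f => by
      have h1 := sum_walkFlow_mul hmem hwalk (fun w => if h : w ∈ Λ then f ⟨w, h⟩ else 0)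
      simpa [v] using h1
  refine le_trans ?_ key
  have h1 := card_common_edges_le (Λ := Λ) (v := v) (w := v) (M := 1) (fun _ => True)
    (fun _ _ _ _ => trivial) Function.injective_id
  simp only [filter_true, card_range, id] at h1
  simp only [univ_unique, sum_singleton, Fintype.card_unit, Nat.cast_one, one_pow, div_one]
  exact sub_le_sub_left
    ((pow_le_pow_right₀ (one_le_pow₀ hci) h1).trans_eq (pow_one _)) _

end NishimoriXY

end

/-! ### Properties of the Gibbs state, axis segments, and the geometry of the ball. -/

section

open MeasureTheory

namespace NishimoriXY

variable {d : ℕ} {Λ : Finset (Site d)}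

theorem continuous_interaction (β : ℝ) (h : Λ → ℝ) (ω : Λ → Λ → ℝ) (ψ : Λ → ℝ) :
    Continuous (interaction Λ β h ω ψ) := by
  unfold interaction; fun_prop

theorem integrableOn_spins {F : (Λ → ℝ) → ℝ} (hF : Continuous F) : IntegrableOn F (spins Λ) :=
  (hF.continuousOn.integrableOn_compact (K := Set.univ.pi fun _ => Set.Icc 0 (2 * Real.pi))
    (isCompact_univ_pi fun _ => isCompact_Icc)).mono_set
    (Set.pi_mono fun _ _ => Set.Ico_subset_Icc_self)

theorem integrableOn_mul_exp_interaction (β : ℝ) (h : Λ → ℝ) (ω : Λ → Λ → ℝ) (ψ : Λ → ℝ)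
    {f : (Λ → ℝ) → ℝ} (hf : Continuous f) :
    IntegrableOn (fun θ => f θ * Real.exp (interaction Λ β h ω ψ θ)) (spins Λ) :=
  integrableOn_spins (hf.mul (Real.continuous_exp.comp (continuous_interaction β h ω ψ)))

theorem partitionFunction_pos (β : ℝ) (h : Λ → ℝ) (ω : Λ → Λ → ℝ) (ψ : Λ → ℝ) :
    0 < partitionFunction Λ β h ω ψ := by
  rw [partitionFunction, setIntegral_pos_iff_support_of_nonneg_ae
    (Filter.Eventually.of_forall fun t => (Real.exp_pos _).le)
    (integrableOn_spins (Real.continuous_exp.comp (continuous_interaction β h ω ψ)))]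
  have : Function.support (fun θ => Real.exp (interaction Λ β h ω ψ θ)) = Set.univ := by
    ext t; simp [Real.exp_ne_zero]
  rw [this, Set.univ_inter, spins, volume_pi, Measure.pi_pi, Finset.prod_const, Real.volume_Ico,
    sub_zero]
  exact ENNReal.pow_pos (ENNReal.ofReal_pos.2 Real.two_pi_pos) _

theorem gibbs_const (β : ℝ) (h : Λ → ℝ) (ω : Λ → Λ → ℝ) (ψ : Λ → ℝ) (r : ℝ) :
    gibbs Λ β h ω ψ (fun _ => r) = r := by
  have hZ := partitionFunction_pos β h ω ψ
  rw [gibbs, integral_const_mul, ← partitionFunction]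
  field_simp

theorem gibbs_mono (β : ℝ) (h : Λ → ℝ) (ω : Λ → Λ → ℝ) (ψ : Λ → ℝ) {f g : (Λ → ℝ) → ℝ}
    (hf : Continuous f) (hg : Continuous g) (hfg : ∀ θ, f θ ≤ g θ) :
    gibbs Λ β h ω ψ f ≤ gibbs Λ β h ω ψ g := by
  refine mul_le_mul_of_nonneg_left (integral_mono (integrableOn_mul_exp_interaction β h ω ψ hf)
    (integrableOn_mul_exp_interaction β h ω ψ hg) fun θ => ?_)
    (inv_pos.2 (partitionFunction_pos β h ω ψ)).le
  exact mul_le_mul_of_nonneg_right (hfg θ) (Real.exp_pos _).le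

theorem gibbs_add (β : ℝ) (h : Λ → ℝ) (ω : Λ → Λ → ℝ) (ψ : Λ → ℝ) {f g : (Λ → ℝ) → ℝ}
    (hf : Continuous f) (hg : Continuous g) :
    gibbs Λ β h ω ψ (fun θ => f θ + g θ) = gibbs Λ β h ω ψ f + gibbs Λ β h ω ψ g := by
  simp only [gibbs, add_mul]
  rw [integral_add (integrableOn_mul_exp_interaction β h ω ψ hf)
    (integrableOn_mul_exp_interaction β h ω ψ hg), mul_add]

theorem gibbs_const_mul (β : ℝ) (h : Λ → ℝ) (ω : Λ → Λ → ℝ) (ψ : Λ → ℝ) (r : ℝ)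
    (f : (Λ → ℝ) → ℝ) : gibbs Λ β h ω ψ (fun θ => r * f θ) = r * gibbs Λ β h ω ψ f := by
  simp only [gibbs, mul_assoc, integral_const_mul]
  ring

theorem abs_gibbs_le_one (β : ℝ) (h : Λ → ℝ) (ω : Λ → Λ → ℝ) (ψ : Λ → ℝ) {f : (Λ → ℝ) → ℝ}
    (hf : Continuous f) (h1 : ∀ θ, |f θ| ≤ 1) : |gibbs Λ β h ω ψ f| ≤ 1 := by
  rw [abs_le]
  constructor
  · rw [← gibbs_const β h ω ψ (-1)]
    exact gibbs_mono β h ω ψ continuous_const hf fun θ => (abs_le.1 (h1 θ)).1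
  · rw [← gibbs_const β h ω ψ 1]
    exact gibbs_mono β h ω ψ hf continuous_const fun θ => (abs_le.1 (h1 θ)).2

/-- Writing the Gibbs weight as a gauge-shifted disorder weight makes it jointly measurable in
disorder and spins. -/
theorem measurable_gibbs (β : ℝ) (h : Λ → ℝ) {f : (Λ → ℝ) → ℝ} (hf : Measurable f) :
    Measurable fun ξ : (positiveEdges Λ → ℝ) × (Λ → ℝ) => gibbs Λ β h (oneForm Λ ξ.1) ξ.2 f := by
  have hW : Measurable fun p : ((positiveEdges Λ → ℝ) × (Λ → ℝ)) × (Λ → ℝ) =>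
      disorderWeight Λ β h (gaugeShift Λ p.2 p.1) :=
    (measurable_disorderWeight β h).comp (measurable_gaugeShift.comp measurable_swap)
  simp only [gibbs, partitionFunction, ← disorderWeight_gaugeShift]
  refine Measurable.mul (Measurable.inv ?_) ?_
  · exact hW.stronglyMeasurable.integral_prod_right'.measurable
  · exact ((hf.comp measurable_snd).mul hW).stronglyMeasurable.integral_prod_right'.measurable

instance (β : ℝ) (h : Λ → ℝ) : IsProbabilityMeasure (disorderLaw Λ β h) := by
  unfold disorderLaw; infer_instance

theorem integrable_gibbs (β : ℝ) (h : Λ → ℝ) {f : (Λ → ℝ) → ℝ} (hf : Continuous f)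
    (h1 : ∀ θ, |f θ| ≤ 1) :
    Integrable (fun ξ => gibbs Λ β h (oneForm Λ ξ.1) ξ.2 f) (disorderLaw Λ β h) :=
  Integrable.of_bound (measurable_gibbs β h hf.measurable).aestronglyMeasurable 1
    (ae_of_all _ fun _ => abs_gibbs_le_one β h _ _ hf h1)

/-- This is `|z + w|² ≤ 2 |z|² + 2 |w|²` for chords of the unit circle, as `|1 - exp (i u)|² = 2 (1
- cos u)`. -/
theorem one_sub_cos_add_le (u v : ℝ) :
    2 * Real.cos u + 2 * Real.cos v + (-3) ≤ Real.cos (u + v) := by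
  rw [Real.cos_add]
  nlinarith [Real.sin_sq_add_cos_sq u, Real.sin_sq_add_cos_sq v,
    sq_nonneg (Real.sin u - Real.sin v), sq_nonneg (Real.cos u + Real.cos v - 2)]

/-- Transitivity of phase coherence. -/
theorem averagedGibbs_triangle (β : ℝ) (h : Λ → ℝ) (x y z : Λ) :
    1 - averagedGibbs Λ β h (fun θ => Real.cos (θ x - θ z)) ≤
      2 * (1 - averagedGibbs Λ β h (fun θ => Real.cos (θ x - θ y))) +
      2 * (1 - averagedGibbs Λ β h (fun θ => Real.cos (θ y - θ z))) := by
  have hcont : ∀ u v : Λ, Continuous fun θ : Λ → ℝ => Real.cos (θ u - θ v) := fun u v => by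
    fun_prop
  have hi := fun u v : Λ => integrable_gibbs β h (hcont u v) fun θ => Real.abs_cos_le_one _
  have hpt : ∀ ω ψ, 2 * gibbs Λ β h ω ψ (fun θ => Real.cos (θ x - θ y)) +
      2 * gibbs Λ β h ω ψ (fun θ => Real.cos (θ y - θ z)) + (-3) ≤
      gibbs Λ β h ω ψ (fun θ => Real.cos (θ x - θ z)) := fun ω ψ => by
    have e1 := gibbs_add β h ω ψ (f := fun θ => 2 * Real.cos (θ x - θ y))
      (g := fun θ => 2 * Real.cos (θ y - θ z)) (by fun_prop) (by fun_prop)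
    have e2 := gibbs_add β h ω ψ (f := fun θ => 2 * Real.cos (θ x - θ y) +
      2 * Real.cos (θ y - θ z)) (g := fun _ => -3) (by fun_prop) continuous_const
    rw [gibbs_const_mul, gibbs_const_mul] at e1
    rw [gibbs_const, e1] at e2
    rw [← e2]
    refine gibbs_mono β h ω ψ (by fun_prop) (hcont x z) fun θ => ?_
    rw [show θ x - θ z = (θ x - θ y) + (θ y - θ z) by ring]
    exact one_sub_cos_add_le _ _
  have i1 : Integrable (fun ξ => 2 * gibbs Λ β h (oneForm Λ ξ.1) ξ.2 (fun θ => Real.cos (θ x - θ y))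
      + 2 * gibbs Λ β h (oneForm Λ ξ.1) ξ.2 (fun θ => Real.cos (θ y - θ z))) (disorderLaw Λ β h) :=
    ((hi x y).const_mul 2).add ((hi y z).const_mul 2)
  have hle : ∫ ξ, (2 * gibbs Λ β h (oneForm Λ ξ.1) ξ.2 (fun θ => Real.cos (θ x - θ y)) +
      2 * gibbs Λ β h (oneForm Λ ξ.1) ξ.2 (fun θ => Real.cos (θ y - θ z)) + (-3))
        ∂(disorderLaw Λ β h) ≤ averagedGibbs Λ β h (fun θ => Real.cos (θ x - θ z)) :=
    integral_mono (i1.add (integrable_const (-3))) (hi x z) fun ξ => hpt (oneForm Λ ξ.1) ξ.2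
  rw [integral_add i1 (integrable_const _), integral_add ((hi x y).const_mul 2)
    ((hi y z).const_mul 2), integral_const_mul, integral_const_mul, integral_const,
    probReal_univ, one_smul] at hle
  rw [← averagedGibbs, ← averagedGibbs] at hle
  linarith

theorem averagedGibbs_symm (β : ℝ) (h : Λ → ℝ) (x y : Λ) :
    averagedGibbs Λ β h (fun θ => Real.cos (θ x - θ y)) =
      averagedGibbs Λ β h (fun θ => Real.cos (θ y - θ x)) := by
  congr 1
  funext θ
  rw [← Real.cos_neg, neg_sub]

theorem averagedGibbs_self (β : ℝ) (h : Λ → ℝ) (x : Λ) :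
    averagedGibbs Λ β h (fun θ => Real.cos (θ x - θ x)) = 1 := by
  simp [averagedGibbs, gibbs_const]

/-- Two points of `Λ` on a line parallel to the axis `a`, with enough room in `Λ`. -/
theorem averagedGibbs_of_axis_of_le (β : ℝ) (h : Λ → ℝ) (x y : Λ) {a b c : Fin d}
    (hab : a ≠ b) (hac : a ≠ c) (hbc : b ≠ c) (L : ℕ)
    (hy : (y : Site d) = Function.update (x : Site d) a ((x : Site d) a + L))
    (hΛ : ∀ z : Site d, ((x : Site d) a ≤ z a ∧ z a ≤ (x : Site d) a + L) →
      (∀ i, i = b ∨ i = c → (x : Site d) i ≤ z i ∧ 2 * (z i - (x : Site d) i) ≤ L) →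
      (∀ i, i ≠ a → i ≠ b → i ≠ c → z i = (x : Site d) i) → z ∈ Λ)
    (hc0 : 0 < phaseFourier β 1) {r : ℝ} (hr : (phaseFourier β 1)⁻¹ ^ 12 = 1 + r)
    (hr2 : r * 1152 ≤ 1 / 2) :
    1 - averagedGibbs Λ β h (fun θ => Real.cos (θ x - θ y)) ≤ 9216 * r := by
  have hci : 1 ≤ (phaseFourier β 1)⁻¹ :=
    (one_le_inv₀ hc0).2 ((le_abs_self _).trans (abs_phaseFourier_le_one β 1))
  have hr0 : (phaseFourier β 1)⁻¹ ^ 2 ≤ 1 + r :=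
    (pow_le_pow_right₀ hci (by norm_num)).trans_eq hr
  have hr1 : 0 ≤ r := by linarith [one_le_pow₀ hci (n := 2)]
  set n := L / 2 with hn
  have hwmem : Function.update (x : Site d) a ((x : Site d) a + 2 * n) ∈ Λ := by
    refine hΛ _ ?_ (fun i hi => ?_) fun i h1 h2 h3 => by simp [h1]
    · rw [Function.update_self]; omega
    · have hia : i ≠ a := by rcases hi with rfl | rfl <;> [exact hab.symm; exact hac.symm]
      rw [Function.update_of_ne hia]; omega
  set w : Λ := ⟨_, hwmem⟩ with hw
  have hwx : (w : Site d) = Function.update (x : Site d) a ((x : Site d) a + 2 * n) := rfl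
  have h1 := averagedGibbs_of_even_distance β h x w hab hac hbc n rfl
    (fun z hz1 hz2 hz3 => hΛ z ⟨hz1.1, by omega⟩
      (fun i hi => ⟨(hz2 i hi).1, by have := (hz2 i hi).2; omega⟩) hz3) hc0 hr hr2
  rcases Nat.mod_two_eq_zero_or_one L with hL | hL
  · have : w = y := Subtype.ext (by rw [hy]; rw [hwx]; congr 1; omega)
    rw [this] at h1
    linarith
  -- For odd `L` one extra edge remains; the triangle inequality gives `2 * 2304 r + 2 r`, within
  -- `9216 r`.
  · have hnn : NearestNeighbor (w : Site d) y := by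
      refine nearestNeighbor_of_coord a ?_ fun j hj => ?_
      · rw [hy, hwx, Function.update_self, Function.update_self]
        rw [show (x : Site d) a + 2 * n - ((x : Site d) a + L) = -1 by omega]
        norm_num
      · rw [hy, hwx, Function.update_of_ne hj, Function.update_of_ne hj]
    have h2 := averagedGibbs_of_nearestNeighbor β h w y hnn hc0
    have h3 := averagedGibbs_triangle β h x w y
    linarith

theorem averagedGibbs_of_axis (β : ℝ) (h : Λ → ℝ) (x y : Λ) {a b c : Fin d}
    (hab : a ≠ b) (hac : a ≠ c) (hbc : b ≠ c)
    (hy : ∀ i ≠ a, (y : Site d) i = (x : Site d) i)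
    (hΛ : ∀ z : Site d, (min ((x : Site d) a) ((y : Site d) a) ≤ z a ∧
        z a ≤ max ((x : Site d) a) ((y : Site d) a)) →
      (∀ i, i = b ∨ i = c → (x : Site d) i ≤ z i ∧
        2 * (z i - (x : Site d) i) ≤ |(x : Site d) a - (y : Site d) a|) →
      (∀ i, i ≠ a → i ≠ b → i ≠ c → z i = (x : Site d) i) → z ∈ Λ)
    (hc0 : 0 < phaseFourier β 1) {r : ℝ} (hr : (phaseFourier β 1)⁻¹ ^ 12 = 1 + r)
    (hr2 : r * 1152 ≤ 1 / 2) :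
    1 - averagedGibbs Λ β h (fun θ => Real.cos (θ x - θ y)) ≤ 9216 * r := by
  rcases le_total ((x : Site d) a) ((y : Site d) a) with hle | hle
  · obtain ⟨L, hL⟩ := Int.eq_ofNat_of_zero_le (sub_nonneg.2 hle)
    rw [min_eq_left hle, max_eq_right hle] at hΛ
    rw [show |(x : Site d) a - (y : Site d) a| = L by rw [abs_sub_comm, hL]; simp] at hΛ
    refine averagedGibbs_of_axis_of_le β h x y hab hac hbc L ?_
      (fun z h1 h2 h3 => hΛ z (by omega) h2 h3) hc0 hr hr2
    funext i
    by_cases hi : i = a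
    · subst hi; rw [Function.update_self]; omega
    · rw [Function.update_of_ne hi, hy i hi]
  · obtain ⟨L, hL⟩ := Int.eq_ofNat_of_zero_le (sub_nonneg.2 hle)
    rw [min_eq_right hle, max_eq_left hle] at hΛ
    rw [show |(x : Site d) a - (y : Site d) a| = L by rw [hL]; simp] at hΛ
    rw [averagedGibbs_symm]
    refine averagedGibbs_of_axis_of_le β h y x hab hac hbc L ?_
      (fun z h1 h2 h3 => hΛ z (by omega) (fun i hi => ?_) fun i hi1 hi2 hi3 => ?_) hc0 hr hr2
    · funext i
      by_cases hi : i = a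
      · subst hi; rw [Function.update_self]; omega
      · rw [Function.update_of_ne hi, hy i hi]
    · have hia : i ≠ a := by rcases hi with rfl | rfl <;> [exact hab.symm; exact hac.symm]
      rw [← hy i hia]
      exact h2 i hi
    · rw [← hy i hi1]
      exact h3 i hi1 hi2 hi3

/-- By `(p + q)² ≤ 2 p² + 2 q²`, four times the squared distance to the midpoint is at most `2 + 4 =
6` times `‖x - y‖²`, well below the available `16`. -/
theorem mem_ball_of_near_box {x y z : Site d} (hxy : x ≠ y) (a b c : Fin d)
    (hz : ∀ i, |2 * z i - x i - y i| ≤ |x i - y i| + if i = b ∨ i = c then |x a - y a| else 0) :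
    z.toEuclidean ∈ Metric.ball ((1 / 2 : ℝ) • (x.toEuclidean + y.toEuclidean))
      (2 * ‖x.toEuclidean - y.toEuclidean‖) := by
  have hD : 0 < ∑ i, ((x i : ℝ) - y i) ^ 2 := by
    obtain ⟨i, hi⟩ := Function.ne_iff.1 hxy
    refine Finset.sum_pos' (fun _ _ => sq_nonneg _) ⟨i, Finset.mem_univ i, ?_⟩
    have : (x i : ℝ) - y i ≠ 0 := sub_ne_zero.2 (by exact_mod_cast hi)
    positivity
  have hterm : ∀ i, (2 * (z i : ℝ) - x i - y i) ^ 2 ≤ 2 * ((x i : ℝ) - y i) ^ 2 +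
      ((if i = b then 2 * ((x a : ℝ) - y a) ^ 2 else 0) +
        if i = c then 2 * ((x a : ℝ) - y a) ^ 2 else 0) := by
    intro i
    have h1 : |2 * (z i : ℝ) - x i - y i| ≤ |(x i : ℝ) - y i| +
        if i = b ∨ i = c then |(x a : ℝ) - y a| else 0 := by
      have := hz i
      split_ifs at this ⊢ <;> exact_mod_cast this
    have h2 : (2 * (z i : ℝ) - x i - y i) ^ 2 ≤ (|(x i : ℝ) - y i| +
        if i = b ∨ i = c then |(x a : ℝ) - y a| else 0) ^ 2 := by
      rw [← sq_abs (2 * (z i : ℝ) - x i - y i)]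
      gcongr
    have h3 : ((if i = b ∨ i = c then |(x a : ℝ) - y a| else 0) ^ 2) * 2 ≤
        (if i = b then 2 * ((x a : ℝ) - y a) ^ 2 else 0) +
        if i = c then 2 * ((x a : ℝ) - y a) ^ 2 else 0 := by
      have := sq_nonneg ((x a : ℝ) - y a)
      by_cases hb : i = b <;> by_cases hc : i = c <;> simp only [hb, hc, if_true, if_false, true_or,
        or_true, or_self, sq_abs] <;> (try split_ifs) <;> nlinarith
    have h4 := sq_abs ((x i : ℝ) - y i)
    nlinarith [sq_nonneg (|(x i : ℝ) - y i| - if i = b ∨ i = c then |(x a : ℝ) - y a| else 0)]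
  have hsum := Finset.sum_le_sum fun i (_ : i ∈ Finset.univ) => hterm i
  rw [Finset.sum_add_distrib, Finset.sum_add_distrib, ← Finset.mul_sum, Finset.sum_ite_eq',
    Finset.sum_ite_eq', if_pos (Finset.mem_univ _), if_pos (Finset.mem_univ _)] at hsum
  have ha := Finset.single_le_sum (f := fun i => ((x i : ℝ) - y i) ^ 2)
    (fun i _ => sq_nonneg _) (Finset.mem_univ a)
  rw [Metric.mem_ball, dist_eq_norm]
  refine lt_of_pow_lt_pow_left₀ 2 (by positivity) ?_
  rw [mul_pow, EuclideanSpace.norm_sq_eq, EuclideanSpace.norm_sq_eq]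
  have h2 : ∀ i, ‖(z.toEuclidean - (1 / 2 : ℝ) • (x.toEuclidean + y.toEuclidean)) i‖ ^ 2 =
      (1 / 4) * (2 * (z i : ℝ) - x i - y i) ^ 2 := fun i => by
    rw [Real.norm_eq_abs, sq_abs]
    simp only [Site.toEuclidean, PiLp.sub_apply, PiLp.smul_apply, PiLp.add_apply, smul_eq_mul]
    ring
  have h3 : ∀ i, ‖(x.toEuclidean - y.toEuclidean) i‖ ^ 2 = ((x i : ℝ) - y i) ^ 2 := fun i => by
    rw [Real.norm_eq_abs, sq_abs]
    simp only [Site.toEuclidean, PiLp.sub_apply]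
  simp only [h2, h3, ← Finset.mul_sum]
  linarith

end NishimoriXY

end

/-! ### General pairs of points and the choice of constants. -/

namespace NishimoriXY

variable {d : ℕ} {Λ : Finset (Site d)}

theorem exists_pair_ne (hd : 3 ≤ d) (a : Fin d) : ∃ b c : Fin d, a ≠ b ∧ a ≠ c ∧ b ≠ c := by
  have hcard : 1 < (Finset.univ.erase a).card := by
    rw [Finset.card_erase_of_mem (Finset.mem_univ a), Finset.card_univ, Fintype.card_fin]
    omega
  obtain ⟨b, hb, c, hc, hbc⟩ := Finset.one_lt_card.1 hcard
  exact ⟨b, c, (Finset.ne_of_mem_erase hb).symm, (Finset.ne_of_mem_erase hc).symm, hbc⟩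

/-- The lattice point whose first `m` coordinates are those of `y` and the others those of `x`. -/
def interpolate (x y : Site d) (m : ℕ) : Site d := fun i => if (i : ℕ) < m then y i else x i

theorem interpolate_cases (x y : Site d) (m : ℕ) (i : Fin d) :
    interpolate x y m i = x i ∨ interpolate x y m i = y i := by
  unfold interpolate; split_ifs <;> simp

/-- Replace the coordinates of `x` by those of `y` one at a time. Every segment, with its transverse
excursions of at most half its length, stays in the ball, and each use of the triangle inequality
costs at most a factor `4`. -/
theorem one_sub_averagedGibbs_le (hd : 3 ≤ d) (β : ℝ) (h : Λ → ℝ) (x y : Λ) (hxy : x ≠ y)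
    (hΛ : ∀ z : Site d, z.toEuclidean ∈ Metric.ball
      ((1 / 2 : ℝ) • (Site.toEuclidean (x : Site d) + Site.toEuclidean (y : Site d)))
      (2 * ‖Site.toEuclidean (x : Site d) - Site.toEuclidean (y : Site d)‖) → z ∈ Λ)
    (hc0 : 0 < phaseFourier β 1) {r : ℝ} (hr : (phaseFourier β 1)⁻¹ ^ 12 = 1 + r)
    (hr2 : r * 1152 ≤ 1 / 2) :
    1 - averagedGibbs Λ β h (fun θ => Real.cos (θ x - θ y)) ≤ 4 ^ d * (9216 * r) := by
  have hxy' : (x : Site d) ≠ y := fun hh => hxy (Subtype.ext hh)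
  have hbox : ∀ (a b c : Fin d) (z : Site d), (∀ i, |2 * z i - (x : Site d) i - (y : Site d) i| ≤
      |(x : Site d) i - (y : Site d) i| +
        if i = b ∨ i = c then |(x : Site d) a - (y : Site d) a| else 0) → z ∈ Λ :=
    fun a b c z hz => hΛ z (mem_ball_of_near_box hxy' a b c hz)
  have hend : ∀ u v w : ℤ, u = v ∨ u = w → |2 * u - v - w| = |v - w| := by
    rintro u v w (rfl | rfl)
    · rw [show 2 * u - u - w = u - w by ring]
    · rw [show 2 * u - v - u = -(v - u) by ring, abs_neg]
  have hmem : ∀ m, interpolate (x : Site d) y m ∈ Λ := fun m => by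
    refine hbox ⟨0, by omega⟩ ⟨0, by omega⟩ ⟨0, by omega⟩ _ fun i => ?_
    rw [hend _ _ _ (interpolate_cases _ _ m i)]
    have := abs_nonneg ((x : Site d) ⟨0, by omega⟩ - (y : Site d) ⟨0, by omega⟩)
    split_ifs <;> omega
  have hr0 : 0 ≤ r := by
    have := one_le_pow₀ ((one_le_inv₀ hc0).2
      ((le_abs_self _).trans (abs_phaseFourier_le_one β 1))) (n := 12)
    linarith
  have key : ∀ m ≤ d, 1 - averagedGibbs Λ β h
      (fun θ => Real.cos (θ x - θ ⟨interpolate (x : Site d) y m, hmem m⟩)) ≤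
        4 ^ m * (9216 * r) := by
    intro m
    induction m with
    | zero =>
      intro _
      have : (⟨interpolate (x : Site d) y 0, hmem 0⟩ : Λ) = x :=
        Subtype.ext (by funext i; simp [interpolate])
      rw [this, averagedGibbs_self]
      linarith
    | succ m ih =>
      intro hm
      have ih := ih (by omega)
      set a : Fin d := ⟨m, by omega⟩ with ha
      obtain ⟨b, c, hab, hac, hbc⟩ := exists_pair_ne hd a
      have ha0 : interpolate (x : Site d) y m a = (x : Site d) a := by simp [interpolate, ha]
      have ha1 : interpolate (x : Site d) y (m + 1) a = (y : Site d) a := by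
        simp [interpolate, ha]
      have hstep := averagedGibbs_of_axis β h ⟨interpolate (x : Site d) y m, hmem m⟩
        ⟨interpolate (x : Site d) y (m + 1), hmem (m + 1)⟩ hab hac hbc (fun i hi => ?_)
        (fun z h1 h2 h3 => hbox a b c z fun i => ?_) hc0 hr hr2
      · have htri := averagedGibbs_triangle β h x ⟨interpolate (x : Site d) y m, hmem m⟩
          ⟨interpolate (x : Site d) y (m + 1), hmem (m + 1)⟩
        have h4 : (1 : ℝ) ≤ 4 ^ m := one_le_pow₀ (by norm_num)
        have h5 : 0 ≤ 9216 * r := by linarith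
        rw [pow_succ]
        nlinarith
      · have : (i : ℕ) ≠ m := fun hh => hi (Fin.ext hh)
        simp only [interpolate]
        split_ifs <;> first | rfl | omega
      · simp only [ha0, ha1] at h1 h2
        by_cases hia : i = a
        · subst hia
          rw [if_neg (by rintro (hh | hh) <;> [exact hab hh; exact hac hh]), add_zero]
          have h6 := le_abs_self ((x : Site d) a - (y : Site d) a)
          have h7 := neg_abs_le ((x : Site d) a - (y : Site d) a)
          rw [abs_le]
          rcases le_total ((x : Site d) a) ((y : Site d) a) with hle | hle
          · rw [min_eq_left hle, max_eq_right hle] at h1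
            omega
          · rw [min_eq_right hle, max_eq_left hle] at h1
            omega
        · have h6 := hend _ _ _ (interpolate_cases (x : Site d) y m i)
          by_cases hibc : i = b ∨ i = c
          · rw [if_pos hibc]
            have h7 := h2 i hibc
            rw [← h6]
            have h8 := abs_add_le (2 * interpolate (x : Site d) y m i - (x : Site d) i -
              (y : Site d) i) (2 * (z i - interpolate (x : Site d) y m i))
            rw [abs_of_nonneg (by omega : 0 ≤ 2 * (z i - interpolate (x : Site d) y m i)),
              show 2 * interpolate (x : Site d) y m i - (x : Site d) i - (y : Site d) i +
                2 * (z i - interpolate (x : Site d) y m i) =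
                2 * z i - (x : Site d) i - (y : Site d) i by ring] at h8
            omega
          · rw [if_neg hibc, add_zero, ← h6]
            rw [not_or] at hibc
            rw [h3 i hia hibc.1 hibc.2]
  have hlast : (⟨interpolate (x : Site d) y d, hmem d⟩ : Λ) = y :=
    Subtype.ext (by funext i; simp [interpolate])
  have := key d le_rfl
  rwa [hlast] at this

theorem interaction_zero_field_add_const (β : ℝ) (ω : Λ → Λ → ℝ) (ψ θ : Λ → ℝ) (α : ℝ) :
    interaction Λ β 0 ω ψ (fun j => θ j + α) = interaction Λ β 0 ω ψ θ := by
  simp [interaction]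

/-- Bernoulli gives `c ^ 12 ≥ 1 - 48 l`, and `1 / (1 - t) ≤ 1 + 2 t` for `0 ≤ t ≤ 1 / 2`. -/
theorem inv_pow_twelve_sub_one_le {c l : ℝ} (hl : 0 ≤ l) (hl2 : l ≤ 1 / 96) (hc : 1 - c ≤ 4 * l) :
    c⁻¹ ^ 12 - 1 ≤ 96 * l := by
  have h1 : 1 - 48 * l ≤ c ^ 12 := by
    have h2 := one_add_mul_le_pow (a := -(4 * l)) (by linarith) 12
    have h3 : (1 + -(4 * l)) ^ 12 ≤ c ^ 12 := pow_le_pow_left₀ (by linarith) (by linarith) 12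
    push_cast at h2
    linarith
  have h4 : 0 < c ^ 12 := by linarith
  rw [inv_pow, sub_le_iff_le_add, inv_le_iff_one_le_mul₀ h4]
  nlinarith

end NishimoriXY

theorem theorem1p3 (d : ℕ) (hd : 3 ≤ d) :
    (∃ βstar a : ℝ, 0 < βstar ∧ 0 < a ∧
      ∀ β : ℝ, βstar ≤ β →
      ∀ (Λ : Finset (NishimoriXY.Site d)) (h : Λ → ℝ) (x y : Λ),
        (∀ z : NishimoriXY.Site d,
          z.toEuclidean ∈ Metric.ball
            ((1 / 2 : ℝ) • (NishimoriXY.Site.toEuclidean (x : NishimoriXY.Site d)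
              + NishimoriXY.Site.toEuclidean (y : NishimoriXY.Site d)))
            (2 * ‖NishimoriXY.Site.toEuclidean (x : NishimoriXY.Site d)
              - NishimoriXY.Site.toEuclidean (y : NishimoriXY.Site d)‖) → z ∈ Λ) →
        1 - Real.sqrt (a * Real.log β / β) ≤
          NishimoriXY.averagedGibbs Λ β h (fun θ => Real.cos (θ x - θ y))) ∧
    (∀ (β : ℝ) (Λ : Finset (NishimoriXY.Site d)) (ω : Λ → Λ → ℝ) (ψ θ : Λ → ℝ) (α : ℝ),
      NishimoriXY.interaction Λ β 0 ω ψ (fun j => θ j + α) =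
        NishimoriXY.interaction Λ β 0 ω ψ θ) := by
  refine ⟨?_, fun β Λ ω ψ θ α => NishimoriXY.interaction_zero_field_add_const β ω ψ θ α⟩
  -- With `r ≤ 96 l`, the condition `1152 r ≤ 1 / 2` holds as soon as `l ≤ 1 / 221184`.
  obtain ⟨B, hB⟩ := Filter.eventually_atTop.1
    (Real.isLittleO_log_id_atTop.def (show (0 : ℝ) < 1 / 221184 by norm_num))
  -- Here `884736 = 9216 * 96`; the linear bound in `l` is weakened to the square root by `l ^ 2 ≤
  -- l`.
  refine ⟨max B 3, (4 ^ d * 884736) ^ 2, by positivity, by positivity, ?_⟩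
  intro β hβ Λ h x y hΛ
  have hβ3 : 3 ≤ β := (le_max_right _ _).trans hβ
  have hβ0 : 0 < β := by linarith
  set l := Real.log β / β with hl
  have hl0 : 0 ≤ l := div_nonneg (Real.log_nonneg (by linarith)) hβ0.le
  have hl1 : l ≤ 1 / 221184 := by
    have h1 := hB β ((le_max_left _ _).trans hβ)
    rw [id, Real.norm_eq_abs, Real.norm_eq_abs, abs_of_pos hβ0] at h1
    rw [hl, div_le_iff₀ hβ0]
    exact (le_abs_self _).trans h1
  have hsqrt : 4 ^ d * 884736 * l ≤ Real.sqrt ((4 ^ d * 884736) ^ 2 * Real.log β / β) := by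
    refine Real.le_sqrt_of_sq_le ?_
    rw [mul_div_assoc, ← hl, mul_pow]
    have : l ^ 2 ≤ l := by nlinarith
    gcongr
  -- For `x = y` the open ball is empty and gives no information, but the correlation is `1`.
  by_cases hxy : x = y
  · rw [hxy, NishimoriXY.averagedGibbs_self]
    linarith [Real.sqrt_nonneg ((4 ^ d * 884736) ^ 2 * Real.log β / β)]
  have hc := NishimoriXY.one_sub_phaseFourier_le hβ3
  rw [← hl] at hc
  have hr := NishimoriXY.inv_pow_twelve_sub_one_le hl0 (by linarith) hc
  have hmain := NishimoriXY.one_sub_averagedGibbs_le hd β h x y hxy hΛ (by linarith)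
    (r := (NishimoriXY.phaseFourier β 1)⁻¹ ^ 12 - 1) (by ring) (by linarith)
  have h4 : (0 : ℝ) < 4 ^ d := by positivity
  have h5 := mul_le_mul_of_nonneg_left hr h4.le
  linarith
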